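/- Let $d\ge 1$ be an integer, let $R>0$ be real, and put $s=\lfloor R\rfloor+1$. For vectors $a_1,\dots,a_n\in\mathbb R^d$ and independent signs $\xi_1,\dots,\xi_n$ with $\mathbb P(\xi_i=1)=\mathbb P(\xi_i=-1)=\tfrac12$, let $$p(d,R,\mathrm{Ber},n)=\sup_{a_1,\dots,a_n}\ \sup_{x\in\mathbb R^d}\ \mathbb P\bigl(a_1\xi_1+\dots+a_n\xi_n\in B(x,R)\bigr),$$ where $B(x,R)$ is the closed Euclidean ball of radius $R$ centered at $x$, and the outer supremum is over all $n$-tuples (multisets of size $n$) of vectors in $\mathbb R^d$ of Euclidean norm at least $1$. Let $S(n,s)$ be the sum of the $s$ largest of the binomial coefficients $\binom ni$, $0\le i\le n$ (the sum of all of them if $s>n+1$). Suppose that $s-1\le R<\sqrt{(s-1)^2+1}$. Then there exists $n_0=n_0(R,d)$ such that for all $n\ge n_0$ $$p(d,R,\mathrm{Ber},n)=2^{-n}S(n,s).$$ If moreover $R>s-1$ (that is, $R$ is not an integer), then for all $n\ge n_0$ the same equality also holds when $B(x,R)$ is replaced by the open ball of radius $R$ centered at $x$ in the definition of $p(d,R,\mathrm{Ber},n)$.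 -/

import Mathlib

open MeasureTheory
open scoped ENNReal

namespace LittlewoodOfford

/-- The law of a random sign: the values `1` and `-1`, each with probability `1/2`. -/
noncomputable def bernoulliSign : Measure ℝ :=
  (2⁻¹ : ℝ≥0∞) • Measure.dirac 1 + (2⁻¹ : ℝ≥0∞) • Measure.dirac (-1)

instance : IsProbabilityMeasure bernoulliSign :=
  ⟨by simp [bernoulliSign, ENNReal.inv_two_add_inv_two]⟩

/-- `sumProb μ a B` is the probability that `a₁ ξ₁ + ⋯ + aₙ ξₙ` lies in `B`, where the `ξᵢ` are
independent real random variables with common law `μ` (their joint law is the product measure). -/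
noncomputable def sumProb {d n : ℕ} (μ : Measure ℝ) [IsProbabilityMeasure μ]
    (a : Fin n → EuclideanSpace ℝ (Fin d)) (B : Set (EuclideanSpace ℝ (Fin d))) : ℝ≥0∞ :=
  (Measure.pi fun _ : Fin n => μ) {ξ : Fin n → ℝ | ∑ i, ξ i • a i ∈ B}

/-- Small ball probability of the multiset `{a₁, …, aₙ}` for closed balls of radius `R`. -/
noncomputable def rho {d n : ℕ} (R : ℝ) (μ : Measure ℝ) [IsProbabilityMeasure μ]
    (a : Fin n → EuclideanSpace ℝ (Fin d)) : ℝ≥0∞ :=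
  ⨆ x : EuclideanSpace ℝ (Fin d), sumProb μ a (Metric.closedBall x R)

/-- Small ball probability of the multiset `{a₁, …, aₙ}` for open balls of radius `R`. -/
noncomputable def rhoOpen {d n : ℕ} (R : ℝ) (μ : Measure ℝ) [IsProbabilityMeasure μ]
    (a : Fin n → EuclideanSpace ℝ (Fin d)) : ℝ≥0∞ :=
  ⨆ x : EuclideanSpace ℝ (Fin d), sumProb μ a (Metric.ball x R)

/-- Supremum of the small ball probability (closed balls of radius `R`) over all multisets of `n`
vectors of Euclidean norm at least `1` in `ℝᵈ`. -/
noncomputable def p (d : ℕ) (R : ℝ) (μ : Measure ℝ) [IsProbabilityMeasure μ] (n : ℕ) : ℝ≥0∞ :=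
  ⨆ (a : Fin n → EuclideanSpace ℝ (Fin d)) (_ : ∀ i, 1 ≤ ‖a i‖), rho R μ a

/-- The same supremum for open balls of radius `R`. -/
noncomputable def pOpen (d : ℕ) (R : ℝ) (μ : Measure ℝ) [IsProbabilityMeasure μ] (n : ℕ) : ℝ≥0∞ :=
  ⨆ (a : Fin n → EuclideanSpace ℝ (Fin d)) (_ : ∀ i, 1 ≤ ‖a i‖), rhoOpen R μ a

/-- The sum of the `m` largest among the binomial coefficients `n.choose i`, `0 ≤ i ≤ n`
(of all of them if `m > n + 1`): the largest sum over at most `m` distinct indices. -/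
def S (n m : ℕ) : ℕ :=
  ((Finset.range (n + 1)).powerset.filter fun T => T.card ≤ m).sup fun T => ∑ i ∈ T, n.choose i

end LittlewoodOfford

/-! Encode a sign vector by the set A of its plus signs. If A ⊆ B and both signed sums lie in a ball
of radius R, then the vectors indexed by B \ A have a sum of norm at most R. Equal unit vectors give
the lower bound: the s middle layers yield s points spaced by 2, which fit in a ball of radius s -
1.

For the upper bound, S(n,s)/2^n is eventually at least (s - 1/4) `centralProb n`, of order n^(-1/2).
Fix a small ε. If every a_i has more than n/(8s) vectors at distance at least ε from its line, there
are linearly many disjoint pairs spread in two directions, and Gaussian averaging bounds the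
probability by O(1/n) (`exists_card_signedSum_mem_closedBall_le`).

Otherwise all but at most n/(8s) vectors lie within ε of a line ℝe, and sign changes make all
components along e nonnegative. If every component exceeds a threshold τ, no chain of the family has
a gap of s, and Erdős' theorem gives exactly S(n,s). If some v has component at most τ, fix all
signs except those of v and of the near vectors. On a maximal chain of sets of near vectors, each
sign of v allows at most s sets. Both counts being s would put s - 1 near vectors plus v, or s near
vectors minus v, within norm R. Their squared norms are at least about (s-1)² + 1 and s² - 2sτ + 1,
both above R²; this is where the upper bound on R enters. So 2s is replaced by 2s - 1
(`card_le_of_exceptional`), and (s - 1/2) `centralProb N` with N close to n is too small to compete.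
-/

namespace LittlewoodOfford

/-! ### Binomial coefficients -/

/-- The largest binomial coefficient of order `n`, divided by `2 ^ n`. -/
noncomputable def centralProb (n : ℕ) : ℝ := (n.choose (n / 2) : ℝ) / 2 ^ n

/-- Rounding n/2 up treats both parities at once: for odd n the two equal middle coefficients add up
to the next central one. -/
lemma centralProb_eq (n : ℕ) :
    centralProb n = ((n + 1) / 2).centralBinom / 4 ^ ((n + 1) / 2) := by
  rcases Nat.even_or_odd' n with ⟨m, rfl | rfl⟩
  · rw [centralProb, show (2 * m + 1) / 2 = m by omega, show 2 * m / 2 = m by omega,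
      Nat.centralBinom_eq_two_mul_choose, pow_mul]
    norm_num
  · rw [centralProb, show (2 * m + 1 + 1) / 2 = m + 1 by omega, show (2 * m + 1) / 2 = m by omega,
      Nat.centralBinom_eq_two_mul_choose, show 2 * (m + 1) = 2 * m + 1 + 1 by ring,
      Nat.choose_succ_succ, Nat.choose_symm_half, pow_succ, pow_succ, pow_mul]
    push_cast
    field_simp
    norm_num
    ring

lemma centralBinom_div_succ (m : ℕ) :
    ((m + 1).centralBinom / 4 ^ (m + 1) : ℝ) =
      (m.centralBinom / 4 ^ m : ℝ) * ((2 * m + 1) / (2 * m + 2)) := by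
  have h : ((m + 1 : ℕ) : ℝ) * (m + 1).centralBinom = 2 * (2 * m + 1) * m.centralBinom := by
    exact_mod_cast Nat.succ_mul_centralBinom_succ m
  push_cast at h
  rw [pow_succ]
  field_simp
  linarith

/-- Each step multiplies by (2m+1)²/(4m(m+1)) > 1. This plays the role of Stirling's formula when
central probabilities of different orders are compared. -/
lemma mul_sq_centralBinom_div_mono {k m : ℕ} (h : k ≤ m) :
    k * (k.centralBinom / 4 ^ k : ℝ) ^ 2 ≤ m * (m.centralBinom / 4 ^ m : ℝ) ^ 2 := by
  refine monotone_nat_of_le_succ (f := fun m : ℕ => m * (m.centralBinom / 4 ^ m : ℝ) ^ 2)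
    (fun m => ?_) h
  rw [centralBinom_div_succ, mul_pow, mul_comm (_ ^ 2) (_ ^ 2), ← mul_assoc]
  gcongr
  rw [div_pow, ← mul_div_assoc, le_div_iff₀ (by positivity)]
  push_cast
  nlinarith [(Nat.cast_nonneg m : (0 : ℝ) ≤ m)]

lemma sq_centralBinom_div_le (m : ℕ) :
    (m.centralBinom / 4 ^ m : ℝ) ^ 2 ≤ 1 / (2 * m + 1) := by
  induction m with
  | zero => simp
  | succ m ih =>
    rw [centralBinom_div_succ, mul_pow]
    calc _ ≤ 1 / (2 * m + 1 : ℝ) * ((2 * m + 1) / (2 * m + 2)) ^ 2 := by gcongr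
      _ ≤ _ := by
        push_cast
        rw [div_pow, ← mul_div_mul_comm, div_le_div_iff₀ (by positivity) (by positivity)]
        nlinarith [(Nat.cast_nonneg m : (0 : ℝ) ≤ m)]

lemma centralProb_pos (n : ℕ) : 0 < centralProb n := by
  have := Nat.choose_pos (Nat.div_le_self n 2)
  unfold centralProb
  positivity

lemma mul_sq_centralProb_le {N n : ℕ} (h : N ≤ n) :
    N * centralProb N ^ 2 ≤ (n + 1) * centralProb n ^ 2 := by
  have h1 : ((N + 1) / 2) ≤ (n + 1) / 2 := by omega
  have h2 := mul_sq_centralBinom_div_mono h1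
  rw [← centralProb_eq, ← centralProb_eq] at h2
  have h3 : (N : ℝ) ≤ 2 * ((N + 1) / 2 : ℕ) := by exact_mod_cast (by omega)
  have h4 : 2 * (((n + 1) / 2 : ℕ) : ℝ) ≤ n + 1 := by exact_mod_cast (by omega)
  nlinarith [sq_nonneg (centralProb N), sq_nonneg (centralProb n)]

lemma one_le_mul_sq_centralProb {n : ℕ} (h : 1 ≤ n) : 1 ≤ 4 * (n + 1) * centralProb n ^ 2 := by
  have := mul_sq_centralProb_le h
  norm_num [centralProb] at this ⊢
  linarith

lemma choose_le_choose_of_two_mul_le {n r k : ℕ} (h : r ≤ k) (hk : 2 * k ≤ n) :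
    n.choose r ≤ n.choose k := by
  induction k, h using Nat.le_induction with
  | base => rfl
  | succ k _ ih =>
    exact (ih (by omega)).trans (Nat.choose_le_succ_of_lt_half_left (by omega))

lemma choose_le_choose_of_sub_le {n r k : ℕ} (h : n ≤ r + k) (hk : 2 * k ≤ n) :
    n.choose r ≤ n.choose k := by
  rcases lt_or_ge n r with hr | hr
  · simp [Nat.choose_eq_zero_of_lt hr]
  · rw [← Nat.choose_symm hr]
    exact choose_le_choose_of_two_mul_le (by omega) hk

/-- `s` consecutive indices around `n / 2`. -/
def centralLayers (n s : ℕ) : Finset ℕ := Finset.Ico ((n + 1 - s) / 2) ((n + 1 - s) / 2 + s)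

lemma card_centralLayers (n s : ℕ) : (centralLayers n s).card = s := by simp [centralLayers]

lemma centralLayers_subset {n s : ℕ} (h : s ≤ n + 1) :
    centralLayers n s ⊆ Finset.range (n + 1) := by
  intro r hr
  simp only [centralLayers, Finset.mem_Ico, Finset.mem_range] at hr ⊢
  omega

lemma choose_le_of_notMem_centralLayers {n s r : ℕ} (hs : 1 ≤ s) (h : s ≤ n + 1)
    (hr : r ∉ centralLayers n s) : n.choose r ≤ n.choose ((n + 1 - s) / 2) := by
  simp only [centralLayers, Finset.mem_Ico, not_and_or, not_le, not_lt] at hr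
  rcases hr with hr | hr
  · exact choose_le_choose_of_two_mul_le hr.le (by omega)
  · exact choose_le_choose_of_sub_le (by omega) (by omega)

lemma le_choose_of_mem_centralLayers {n s r : ℕ} (h : s ≤ n + 1)
    (hr : r ∈ centralLayers n s) : n.choose ((n + 1 - s) / 2) ≤ n.choose r := by
  simp only [centralLayers, Finset.mem_Ico] at hr
  rcases le_total (2 * r) n with h2 | h2
  · exact choose_le_choose_of_two_mul_le hr.1 h2
  · rw [← Nat.choose_symm (show r ≤ n by omega)]
    exact choose_le_choose_of_two_mul_le (by omega) (by omega)

/-- The fractional knapsack bound. -/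
lemma sum_mul_le_sum_of_threshold {ι : Type*} {U T : Finset ι} (hTU : T ⊆ U) {b x : ι → ℝ}
    {β : ℝ} (hβ : 0 ≤ β) (hx0 : ∀ i ∈ U, 0 ≤ x i) (hx1 : ∀ i ∈ U, x i ≤ 1)
    (hx : ∑ i ∈ U, x i ≤ T.card) (hT : ∀ i ∈ T, β ≤ b i) (hU : ∀ i ∈ U, i ∉ T → b i ≤ β) :
    ∑ i ∈ U, x i * b i ≤ ∑ i ∈ T, b i := by
  classical
  -- After subtracting β, terms off T are nonpositive and terms in T nonnegative; the budget `hx`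
  -- pays for restoring β.
  have h1 : ∑ i ∈ U, x i * (b i - β) ≤ ∑ i ∈ T, (b i - β) := by
    rw [← Finset.sum_sdiff hTU]
    have h2 : ∑ i ∈ U \ T, x i * (b i - β) ≤ 0 := Finset.sum_nonpos fun i hi => by
      rw [Finset.mem_sdiff] at hi
      nlinarith [hx0 i hi.1, hU i hi.1 hi.2]
    have h3 : ∑ i ∈ T, x i * (b i - β) ≤ ∑ i ∈ T, (b i - β) := Finset.sum_le_sum fun i hi => by
      nlinarith [hx1 i (hTU hi), hT i hi]
    linarith
  simp only [mul_sub, Finset.sum_sub_distrib, ← Finset.sum_mul, Finset.sum_const,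
    nsmul_eq_mul] at h1
  nlinarith

lemma sum_mul_choose_le {n s : ℕ} (hs : 1 ≤ s) (h : s ≤ n + 1) {x : ℕ → ℝ}
    (hx0 : ∀ i ∈ Finset.range (n + 1), 0 ≤ x i) (hx1 : ∀ i ∈ Finset.range (n + 1), x i ≤ 1)
    (hx : ∑ i ∈ Finset.range (n + 1), x i ≤ s) :
    ∑ i ∈ Finset.range (n + 1), x i * n.choose i ≤ ∑ i ∈ centralLayers n s, (n.choose i : ℝ) :=
  sum_mul_le_sum_of_threshold (β := n.choose ((n + 1 - s) / 2)) (centralLayers_subset h)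
    (by positivity) hx0 hx1 (by rwa [card_centralLayers])
    (fun i hi => by exact_mod_cast le_choose_of_mem_centralLayers h hi)
    (fun i _ hi => by exact_mod_cast choose_le_of_notMem_centralLayers hs h hi)

lemma S_eq_sum_centralLayers {n s : ℕ} (hs : 1 ≤ s) (h : s ≤ n + 1) :
    S n s = ∑ i ∈ centralLayers n s, n.choose i := by
  refine le_antisymm (Finset.sup_le fun T hT => ?_) ?_
  · rw [Finset.mem_filter, Finset.mem_powerset] at hT
    have := sum_mul_choose_le hs h (x := fun i => if i ∈ T then 1 else 0)
      (fun i _ => by positivity) (fun i _ => by split_ifs <;> norm_num) (by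
        rw [Finset.sum_ite_mem, Finset.inter_eq_right.2 hT.1]
        simpa using hT.2)
    simp only [ite_mul, one_mul, zero_mul] at this
    rw [Finset.sum_ite_mem, Finset.inter_eq_right.2 hT.1] at this
    exact_mod_cast this
  · refine Finset.le_sup (f := fun T => ∑ i ∈ T, n.choose i) ?_
    rw [Finset.mem_filter, Finset.mem_powerset]
    exact ⟨centralLayers_subset h, (card_centralLayers n s).le⟩

/-- The ratio of neighbouring coefficients, (r+1)/(n-r), tends to 1 near the middle; each step
spends half of the remaining error. -/
lemma eventually_choose_sub_ge (k : ℕ) {η : ℝ} (hη : 0 < η) :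
    ∀ᶠ n : ℕ in Filter.atTop, (1 - η) * n.choose (n / 2) ≤ n.choose (n / 2 - k) := by
  induction k generalizing η with
  | zero =>
    refine Filter.Eventually.of_forall fun n => ?_
    have : (0 : ℝ) ≤ n.choose (n / 2) := by positivity
    simp only [Nat.sub_zero]
    nlinarith
  | succ k ih =>
    obtain ⟨M, hM⟩ := exists_nat_gt ((2 * k + 3) / (η / 2))
    filter_upwards [ih (half_pos hη), Filter.eventually_ge_atTop (2 * M + 2 * k + 4)] with n h1 h2
    rw [div_lt_iff₀ (half_pos hη)] at hM
    set r := n / 2 - (k + 1) with hr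
    have hr1 : n / 2 - k = r + 1 := by omega
    rw [hr1] at h1
    have h3 : (n.choose (r + 1) : ℝ) * (r + 1) = n.choose r * (n - r : ℕ) := by
      exact_mod_cast Nat.choose_succ_right_eq n r
    have h4 : ((n - r : ℕ) : ℝ) ≤ r + 1 + (2 * k + 3) := by
      have : n - r ≤ r + 1 + (2 * k + 3) := by omega
      exact_mod_cast this
    have h5 : (M : ℝ) ≤ (n - r : ℕ) := by
      have : M ≤ n - r := by omega
      exact_mod_cast this
    have h6 : (0 : ℝ) < (n - r : ℕ) := by
      have : 0 < n - r := by omega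
      exact_mod_cast this
    have h7 : (0 : ℝ) ≤ n.choose (r + 1) := by positivity
    have h8 : (1 - η / 2) * (n - r : ℕ) ≤ r + 1 := by nlinarith
    have h9 : (1 - η / 2) * n.choose (r + 1) ≤ n.choose r := by
      refine le_of_mul_le_mul_right ?_ h6
      rw [← h3]
      nlinarith
    have h10 : (n.choose (r + 1) : ℝ) ≤ n.choose (n / 2) := by
      exact_mod_cast Nat.choose_le_middle _ _
    nlinarith

/-- Each of the s central coefficients loses a proportion at most 1/(4s). The total loss 1/4 stays
below the 1/2 gained from an exceptional vector. -/
lemma eventually_S_ge {s : ℕ} (hs : 1 ≤ s) :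
    ∀ᶠ n : ℕ in Filter.atTop, ((s : ℝ) - 1 / 4) * n.choose (n / 2) ≤ S n s := by
  have hs' : (0 : ℝ) < s := by exact_mod_cast hs
  filter_upwards [eventually_choose_sub_ge s (η := 1 / (4 * s)) (by positivity),
    Filter.eventually_ge_atTop (2 * s + 2)] with n h1 h2
  have h3 : s * n.choose ((n + 1 - s) / 2) ≤ S n s := by
    rw [S_eq_sum_centralLayers hs (by omega)]
    have := Finset.card_nsmul_le_sum (centralLayers n s) (fun i => n.choose i) _
      fun i hi => le_choose_of_mem_centralLayers (by omega) hi
    rwa [card_centralLayers, smul_eq_mul] at this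
  have h4 : n.choose (n / 2 - s) ≤ n.choose ((n + 1 - s) / 2) :=
    choose_le_choose_of_two_mul_le (by omega) (by omega)
  calc ((s : ℝ) - 1 / 4) * n.choose (n / 2)
      = s * ((1 - 1 / (4 * s)) * n.choose (n / 2)) := by field_simp
    _ ≤ s * n.choose ((n + 1 - s) / 2) := by
      gcongr
      exact h1.trans (by exact_mod_cast h4)
    _ ≤ S n s := by exact_mod_cast h3

/-! ### Families of sets and random maximal chains -/

section Chains

variable {X : Type*} [Fintype X]

/-- The set of the first `k` elements in a numbering. -/
def initSeg (f : Numbering X) (k : ℕ) : Finset X := Finset.univ.filter fun x => (f x : ℕ) < k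

lemma initSeg_mono (f : Numbering X) {k l : ℕ} (h : k ≤ l) : initSeg f k ⊆ initSeg f l := by
  intro x hx
  simp only [initSeg, Finset.mem_filter, Finset.mem_univ, true_and] at hx ⊢
  omega

lemma card_initSeg (f : Numbering X) {k : ℕ} (h : k ≤ Fintype.card X) :
    (initSeg f k).card = k := by
  have : (initSeg f k).map f.toEmbedding =
      Finset.univ.filter fun i : Fin (Fintype.card X) => (i : ℕ) < k := by
    ext i
    simp only [initSeg, Finset.mem_map, Finset.mem_filter, Finset.mem_univ, true_and,
      Equiv.coe_toEmbedding]
    exact ⟨by rintro ⟨x, hx, rfl⟩; exact hx, fun hi => ⟨f.symm i, by simpa using hi, by simp⟩⟩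
  rw [← Finset.card_map f.toEmbedding, this, Fin.card_filter_val_lt, min_eq_right h]

lemma card_initSeg_sdiff [DecidableEq X] (f : Numbering X) {k l : ℕ} (h : k ≤ l) (hl : l ≤ Fintype.card X) :
    (initSeg f l \ initSeg f k).card = l - k := by
  rw [Finset.card_sdiff_of_subset (initSeg_mono f h), card_initSeg f hl,
    card_initSeg f (h.trans hl)]

lemma _root_.Numbering.IsPrefix.eq_initSeg {f : Numbering X} {A : Finset X}
    (h : f.IsPrefix A) : A = initSeg f A.card := by
  ext x
  simp [initSeg, h x]

variable [DecidableEq X]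

/-- A weighted form of the LYM inequality. -/
lemma sum_div_choose_le (g : Finset X → ℕ) (M : ℕ)
    (h : ∀ f : Numbering X, ∑ k ∈ Finset.range (Fintype.card X + 1), g (initSeg f k) ≤ M) :
    ∑ A : Finset X, (g A : ℝ) / (Fintype.card X).choose A.card ≤ M := by
  set N := Fintype.card X with hN
  -- Double counting of pairs (numbering, prefix set): the prefix sets of a numbering are its
  -- initial segments, one of each size.
  have h1 : ∑ A : Finset X, g A * (Numbering.prefixed A).card ≤ N.factorial * M := by
    calc ∑ A : Finset X, g A * (Numbering.prefixed A).card
        = ∑ A : Finset X, ∑ f : Numbering X, if f.IsPrefix A then g A else 0 := by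
          refine Finset.sum_congr rfl fun A _ => ?_
          rw [← Finset.sum_filter, Finset.sum_const, smul_eq_mul, mul_comm]
          rfl
      _ = ∑ f : Numbering X, ∑ A : Finset X, if f.IsPrefix A then g A else 0 := Finset.sum_comm
      _ ≤ ∑ f : Numbering X, M := by
          refine Finset.sum_le_sum fun f _ => le_trans ?_ (h f)
          rw [← Finset.sum_filter]
          have hi : Set.InjOn Finset.card
              (Finset.univ.filter fun A : Finset X => f.IsPrefix A : Set (Finset X)) := by
            intro A hA B hB hAB
            simp only [Finset.coe_filter, Finset.mem_univ, true_and, Set.mem_ofPred_eq] at hA hB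
            rw [hA.eq_initSeg, hB.eq_initSeg, hAB]
          calc ∑ A : Finset X with f.IsPrefix A, g A
              = ∑ A : Finset X with f.IsPrefix A, g (initSeg f A.card) :=
                Finset.sum_congr rfl fun A hA => by
                  rw [← (Finset.mem_filter.1 hA).2.eq_initSeg]
            _ = ∑ k ∈ (Finset.univ.filter fun A : Finset X => f.IsPrefix A).image Finset.card,
                  g (initSeg f k) :=
                (Finset.sum_image (f := fun k => g (initSeg f k)) hi).symm
            _ ≤ _ := by
                refine Finset.sum_le_sum_of_subset fun k hk => ?_
                obtain ⟨A, -, rfl⟩ := Finset.mem_image.1 hk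
                rw [Finset.mem_range]
                exact Nat.lt_succ_of_le (Finset.card_le_univ A)
      _ = N.factorial * M := by simp [Fintype.card_numbering, hN]
  have h2 : (0 : ℝ) < N.factorial := by exact_mod_cast N.factorial_pos
  refine le_of_mul_le_mul_left ?_ h2
  calc (N.factorial : ℝ) * ∑ A : Finset X, (g A : ℝ) / N.choose A.card
      = ∑ A : Finset X, (g A : ℝ) * (Numbering.prefixed A).card := by
        rw [Finset.mul_sum]
        refine Finset.sum_congr rfl fun A _ => ?_
        have h3 := Nat.choose_mul_factorial_mul_factorial (Finset.card_le_univ A)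
        have h4 : (0 : ℝ) < N.choose A.card := by
          exact_mod_cast Nat.choose_pos (Finset.card_le_univ A)
        rw [hN] at h4
        rw [Numbering.card_prefixed, hN, ← h3]
        push_cast
        field_simp
    _ ≤ N.factorial * M := by exact_mod_cast h1

lemma sum_le_mul_choose_middle (g : Finset X → ℕ) (M : ℕ)
    (h : ∀ f : Numbering X, ∑ k ∈ Finset.range (Fintype.card X + 1), g (initSeg f k) ≤ M) :
    ∑ A : Finset X, (g A : ℝ) ≤ M * (Fintype.card X).choose (Fintype.card X / 2) := by
  have h0 : (0 : ℝ) < (Fintype.card X).choose (Fintype.card X / 2) := by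
    exact_mod_cast Nat.choose_pos (Nat.div_le_self _ 2)
  rw [← div_le_iff₀ h0, Finset.sum_div]
  refine le_trans (Finset.sum_le_sum fun A _ => ?_) (sum_div_choose_le g M h)
  have h4 : (0 : ℝ) < (Fintype.card X).choose A.card := by
    exact_mod_cast Nat.choose_pos (Finset.card_le_univ A)
  have h5 : ((Fintype.card X).choose A.card : ℝ) ≤
      (Fintype.card X).choose (Fintype.card X / 2) := by
    exact_mod_cast Nat.choose_le_middle _ _
  gcongr

end Chains

lemma card_le_of_forall_lt_add {T : Finset ℕ} {s : ℕ} (h : ∀ k ∈ T, ∀ l ∈ T, l < k + s) :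
    T.card ≤ s := by
  rcases T.eq_empty_or_nonempty with rfl | hT
  · simp
  · calc T.card ≤ (Finset.Ico (T.min' hT) (T.min' hT + s)).card :=
          Finset.card_le_card fun l hl =>
            Finset.mem_Ico.2 ⟨T.min'_le l hl, h _ (T.min'_mem hT) l hl⟩
      _ = s := by simp

lemma exists_eq_add_of_card_eq {T : Finset ℕ} {s : ℕ} (hs : 1 ≤ s)
    (h : ∀ k ∈ T, ∀ l ∈ T, l < k + s) (hT : T.card = s) : ∃ k ∈ T, k + (s - 1) ∈ T := by
  have hne : T.Nonempty := Finset.card_pos.1 (by omega)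
  refine ⟨T.min' hne, T.min'_mem hne, ?_⟩
  have h1 : T ⊆ Finset.Ico (T.min' hne) (T.min' hne + s) := fun l hl =>
    Finset.mem_Ico.2 ⟨T.min'_le l hl, h _ (T.min'_mem hne) l hl⟩
  have h2 := Finset.eq_of_subset_of_card_le h1 (by simp [hT])
  refine h2.ge (Finset.mem_Ico.2 ?_)
  omega

/-- Two sets of size s would be intervals starting at some i and j; then `h₁` forces j < i and `h₂`
forces i ≤ j. -/
lemma card_add_card_lt_two_mul {T T' : Finset ℕ} {s : ℕ} (hs : 1 ≤ s)
    (h : ∀ k ∈ T, ∀ l ∈ T, l < k + s) (h' : ∀ k ∈ T', ∀ l ∈ T', l < k + s)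
    (h₁ : ∀ k ∈ T, ∀ l ∈ T', l < k + (s - 1)) (h₂ : ∀ k ∈ T', ∀ l ∈ T, l < k + s) :
    T.card + T'.card ≤ 2 * s - 1 := by
  by_contra! hc
  have h3 := card_le_of_forall_lt_add h
  have h4 := card_le_of_forall_lt_add h'
  obtain ⟨i, hi, hi'⟩ := exists_eq_add_of_card_eq hs h (by omega)
  obtain ⟨j, hj, hj'⟩ := exists_eq_add_of_card_eq hs h' (by omega)
  have h5 := h₁ i hi _ hj'
  have h6 := h₂ j hj _ hi'
  omega

/-- Erdős' theorem on families without long chains. -/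
lemma card_le_S_of_forall_card_sdiff_lt {n s : ℕ} (hs : 1 ≤ s) (hn : s ≤ n + 1)
    (F : Finset (Finset (Fin n))) (h : ∀ A ∈ F, ∀ B ∈ F, A ⊆ B → (B \ A).card < s) :
    F.card ≤ S n s := by
  have h1 := sum_div_choose_le (fun A => if A ∈ F then 1 else 0) s fun f => by
    rw [← Finset.sum_filter, Finset.sum_const, smul_eq_mul, mul_one]
    refine card_le_of_forall_lt_add fun k hk l hl => ?_
    simp only [Finset.mem_filter, Finset.mem_range, Fintype.card_fin] at hk hl
    by_contra! hkl
    have := h _ hk.2 _ hl.2 (initSeg_mono f (by omega))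
    rw [card_initSeg_sdiff f (by omega) (by rw [Fintype.card_fin]; omega)] at this
    omega
  rw [Fintype.card_fin] at h1
  -- The filled proportion of each layer. The LYM bound says these add up to at most s, so they are
  -- admissible knapsack weights.
  set x : ℕ → ℝ := fun i => (F.filter fun A => A.card = i).card / n.choose i with hx
  have hpos : ∀ i ∈ Finset.range (n + 1), (0 : ℝ) < n.choose i := fun i hi => by
    exact_mod_cast Nat.choose_pos (by rw [Finset.mem_range] at hi; omega)
  have hmaps : ∀ A ∈ F, A.card ∈ Finset.range (n + 1) := fun A _ => by
    have := Finset.card_le_univ A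
    rw [Fintype.card_fin] at this
    exact Finset.mem_range.2 (by omega)
  have h2 : ∑ i ∈ Finset.range (n + 1), x i ≤ s := by
    refine le_trans (le_of_eq ?_) h1
    calc ∑ i ∈ Finset.range (n + 1), x i
        = ∑ i ∈ Finset.range (n + 1), ∑ A ∈ F with A.card = i, (1 : ℝ) / n.choose A.card := by
          refine Finset.sum_congr rfl fun i _ => ?_
          rw [Finset.sum_congr rfl (g := fun _ => (1 : ℝ) / n.choose i)
            (fun A hA => by rw [(Finset.mem_filter.1 hA).2]), Finset.sum_const, nsmul_eq_mul, hx]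
          ring
      _ = ∑ A ∈ F, (1 : ℝ) / n.choose A.card := Finset.sum_fiberwise_of_maps_to hmaps _
      _ = _ := by
          simp only [Nat.cast_ite, Nat.cast_one, Nat.cast_zero, ite_div, zero_div,
            Finset.sum_ite_mem, Finset.univ_inter]
  have h3 := sum_mul_choose_le hs hn (x := x) (fun i hi => by positivity) (fun i hi => by
    rw [hx, div_le_one (hpos i hi)]
    have : (F.filter fun A => A.card = i) ⊆ Finset.powersetCard i Finset.univ := fun A hA =>
      Finset.mem_powersetCard.2 ⟨Finset.subset_univ A, (Finset.mem_filter.1 hA).2⟩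
    have := Finset.card_le_card this
    rw [Finset.card_powersetCard, Finset.card_univ, Fintype.card_fin] at this
    exact_mod_cast this) h2
  have h4 : ∑ i ∈ Finset.range (n + 1), x i * n.choose i = F.card := by
    rw [Finset.card_eq_sum_card_fiberwise hmaps]
    push_cast
    refine Finset.sum_congr rfl fun i hi => ?_
    rw [hx, div_mul_cancel₀ _ (hpos i hi).ne']
  rw [h4] at h3
  rw [S_eq_sum_centralLayers hs hn]
  exact_mod_cast h3

/-! ### Signed sums -/

section SignedSum

variable {ι : Type*} [DecidableEq ι]

/-- The signs that are `1` on `A` and `-1` off `A`. -/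
def signs (A : Finset ι) (i : ι) : ℝ := if i ∈ A then 1 else -1

lemma signs_symmDiff (A T : Finset ι) (i : ι) :
    signs (symmDiff A T) i = -(signs A i * signs T i) := by
  by_cases h1 : i ∈ A <;> by_cases h2 : i ∈ T <;> simp [signs, Finset.mem_symmDiff, h1, h2]

variable {E : Type*} [AddCommGroup E] [Module ℝ E] [Fintype ι]

/-- The sum of the vectors `a i` with signs `1` on `A` and `-1` off `A`. -/
def signedSum (a : ι → E) (A : Finset ι) : E := ∑ i, signs A i • a i

lemma signedSum_sub_signedSum (a : ι → E) {A B : Finset ι} (h : A ⊆ B) :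
    signedSum a B - signedSum a A = (2 : ℝ) • ∑ i ∈ B \ A, a i := by
  rw [signedSum, signedSum, ← Finset.sum_sub_distrib, ← Finset.sum_subset (Finset.subset_univ
    (B \ A)), Finset.smul_sum]
  · refine Finset.sum_congr rfl fun i hi => ?_
    rw [Finset.mem_sdiff] at hi
    rw [signs, signs, if_pos hi.1, if_neg hi.2, ← sub_smul]
    norm_num
  · intro i _ hi
    rw [Finset.mem_sdiff, not_and_not_right] at hi
    by_cases hA : i ∈ A
    · simp [signs, hA, h hA]
    · simp [signs, hA, mt hi hA]

lemma signedSum_symmDiff (a : ι → E) (A T : Finset ι) :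
    signedSum a (symmDiff A T) = signedSum (fun i => -(signs T i • a i)) A := by
  refine Finset.sum_congr rfl fun i _ => ?_
  rw [signs_symmDiff, smul_neg, neg_smul, mul_smul]

-- Symmetric difference with T permutes the sets, so negating some of the vectors changes no count.
open Classical in
lemma card_signedSum_neg_signs (a : ι → E) (T : Finset ι) (B : Set E) :
    (Finset.univ.filter fun A => signedSum (fun i => -(signs T i • a i)) A ∈ B).card =
      (Finset.univ.filter fun A => signedSum a A ∈ B).card := by
  refine Finset.card_bij' (fun A _ => symmDiff A T) (fun A _ => symmDiff A T) ?_ ?_ ?_ ?_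
  · intro A hA
    simpa [signedSum_symmDiff] using hA
  · intro A hA
    simpa [← signedSum_symmDiff] using hA
  · intro A _
    simp
  · intro A _
    simp

lemma signedSum_const (v : E) (A : Finset ι) :
    signedSum (fun _ => v) A = (2 * (A.card : ℝ) - Fintype.card ι) • v := by
  rw [signedSum, ← Finset.sum_smul]
  congr 1
  simp only [signs, Finset.sum_ite, Finset.sum_const, Finset.filter_mem_eq_inter,
    Finset.univ_inter, Finset.filter_not, ← Finset.compl_eq_univ_sdiff, Finset.card_compl]
  rw [nsmul_eq_mul, nsmul_eq_mul, Nat.cast_sub (Finset.card_le_univ A)]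
  ring

end SignedSum

/-! ### From product measure to counting subsets -/

lemma pi_bernoulliSign (n : ℕ) :
    Measure.pi (fun _ : Fin n => bernoulliSign) =
      ∑ A : Finset (Fin n), (2⁻¹ : ℝ≥0∞) ^ n • Measure.dirac (signs A) := by
  refine Measure.pi_eq fun t ht => ?_
  have h1 : ∀ i, bernoulliSign (t i) =
      2⁻¹ * (t i).indicator 1 1 + 2⁻¹ * (t i).indicator 1 (-1) := fun i => by
    simp [bernoulliSign, Measure.dirac_apply' _ (ht i)]
  simp only [h1, Finset.prod_add, Finset.powerset_univ, Measure.finsetSum_apply,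
    Measure.smul_apply, smul_eq_mul]
  refine Finset.sum_congr rfl fun A _ => ?_
  rw [Measure.dirac_apply' _ (MeasurableSet.univ_pi ht), Finset.prod_mul_distrib,
    Finset.prod_mul_distrib, Finset.prod_const, Finset.prod_const, mul_mul_mul_comm, ← pow_add,
    ← Finset.compl_eq_univ_sdiff, Finset.card_add_card_compl, Fintype.card_fin]
  congr 1
  have h2 : (Set.univ.pi t).indicator (1 : (Fin n → ℝ) → ℝ≥0∞) (signs A) =
      ∏ i, (t i).indicator 1 (signs A i) := by
    by_cases h : signs A ∈ Set.univ.pi t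
    · rw [Set.indicator_of_mem h, Finset.prod_eq_one]
      · rfl
      · exact fun i _ => Set.indicator_of_mem (h i (Set.mem_univ i)) _
    · rw [Set.indicator_of_notMem h]
      simp only [Set.mem_univ_pi, not_forall] at h
      obtain ⟨i, hi⟩ := h
      exact (Finset.prod_eq_zero (Finset.mem_univ i) (Set.indicator_of_notMem hi _)).symm
  rw [h2, ← Finset.prod_mul_prod_compl A]
  congr 1
  · exact Finset.prod_congr rfl fun i hi => by simp [signs, hi]
  · exact Finset.prod_congr rfl fun i hi => by simp [signs, Finset.mem_compl.1 hi]

open Classical in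
lemma sumProb_bernoulliSign {d n : ℕ} (a : Fin n → EuclideanSpace ℝ (Fin d))
    {B : Set (EuclideanSpace ℝ (Fin d))} (hB : MeasurableSet B) :
    sumProb bernoulliSign a B =
      ((Finset.univ.filter fun A => signedSum a A ∈ B).card : ℝ≥0∞) / 2 ^ n := by
  have hm : MeasurableSet {ξ : Fin n → ℝ | ∑ i, ξ i • a i ∈ B} :=
    (show Continuous fun ξ : Fin n → ℝ => ∑ i, ξ i • a i by fun_prop).measurable hB
  rw [sumProb, pi_bernoulliSign, Measure.finsetSum_apply]
  simp only [Measure.smul_apply, smul_eq_mul, Measure.dirac_apply' _ hm]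
  rw [← Finset.mul_sum, mul_comm, ENNReal.div_eq_inv_mul, mul_comm, ENNReal.inv_pow,
    Finset.card_filter]
  push_cast
  rfl

/-! ### Anticoncentration in two directions -/

section Trigonometry

variable {ι : Type*} [DecidableEq ι]

/-- The phase φ must vary in the induction, since each new sign shifts it by ± θ j. -/
lemma sum_powerset_cos (s : Finset ι) (θ : ι → ℝ) (φ : ℝ) :
    ∑ A ∈ s.powerset, Real.cos (∑ i ∈ s, signs A i * θ i + φ) =
      2 ^ s.card * ((∏ i ∈ s, Real.cos (θ i)) * Real.cos φ) := by
  induction s using Finset.induction_on generalizing φ with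
  | empty => simp
  | insert j s hj ih =>
    have h1 : ∀ A ∈ s.powerset, ∑ i ∈ insert j s, signs A i * θ i + φ =
        ∑ i ∈ s, signs A i * θ i + (φ - θ j) := fun A hA => by
      rw [Finset.sum_insert hj, signs, if_neg fun h => hj (Finset.mem_powerset.1 hA h)]
      ring
    have h2 : ∀ A ∈ s.powerset, ∑ i ∈ insert j s, signs (insert j A) i * θ i + φ =
        ∑ i ∈ s, signs A i * θ i + (φ + θ j) := fun A hA => by
      rw [Finset.sum_insert hj, signs, if_pos (Finset.mem_insert_self j A)]
      have : ∑ i ∈ s, signs (insert j A) i * θ i = ∑ i ∈ s, signs A i * θ i :=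
        Finset.sum_congr rfl fun i hi => by
          have : i ≠ j := fun h => hj (h ▸ hi)
          simp [signs, this]
      rw [this]
      ring
    rw [Finset.sum_powerset_insert hj, Finset.sum_congr rfl fun A hA => congrArg Real.cos (h1 A hA),
      Finset.sum_congr rfl fun A hA => congrArg Real.cos (h2 A hA), ih, ih, Finset.prod_insert hj,
      Finset.card_insert_of_notMem hj, pow_succ, Real.cos_sub, Real.cos_add]
    ring

lemma sum_cos_signs [Fintype ι] (θ : ι → ℝ) (φ : ℝ) :
    ∑ A : Finset ι, Real.cos (∑ i, signs A i * θ i + φ) =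
      2 ^ Fintype.card ι * ((∏ i, Real.cos (θ i)) * Real.cos φ) := by
  rw [← Finset.powerset_univ, sum_powerset_cos, Finset.card_univ]

end Trigonometry

lemma two_pow_mul_cos_pow_mul_cos (k : ℕ) (θ φ : ℝ) :
    2 ^ k * (Real.cos θ ^ k * Real.cos φ) =
      ∑ j ∈ Finset.range (k + 1), k.choose j * Real.cos ((2 * j - k) * θ + φ) := by
  have h1 := sum_cos_signs (fun _ : Fin k => θ) φ
  rw [Finset.prod_const, Finset.card_univ, Fintype.card_fin] at h1
  have h2 : ∀ A : Finset (Fin k), ∑ i, signs A i * θ = (2 * A.card - k) * θ := fun A => by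
    simpa [signedSum] using signedSum_const θ A
  simp only [h2] at h1
  have h3 := Finset.sum_powerset_apply_card
    (fun j => Real.cos ((2 * j - k) * θ + φ)) (x := (Finset.univ : Finset (Fin k)))
  rw [Finset.powerset_univ, Finset.card_univ, Fintype.card_fin] at h3
  rw [← h1, h3]
  simp

lemma summable_exp_neg_mul_sq {b : ℝ} (hb : 0 < b) :
    Summable fun z : ℤ => Real.exp (-b * (z : ℝ) ^ 2) := by
  have h1 : Summable fun n : ℕ => Real.exp (-b * (n : ℝ) ^ 2) := by
    refine Summable.of_nonneg_of_le (fun _ => (Real.exp_pos _).le) (fun n => ?_)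
      (Real.summable_exp_nat_mul_iff.2 (neg_lt_zero.2 hb))
    refine Real.exp_le_exp.2 ?_
    have : (n : ℝ) ≤ (n : ℝ) ^ 2 := by exact_mod_cast Nat.le_self_pow two_ne_zero n
    nlinarith
  exact Summable.of_nat_of_neg (by simpa using h1) (by simpa using h1)

/-- The points are spaced by 2α ≥ 2b, so a theta series dominates the sum; moving its centre to the
nearest integer costs the factor exp(b²/2), whatever the shift c. -/
lemma exists_sum_exp_neg_sq_le {b : ℝ} (hb : 0 < b) :
    ∃ C : ℝ, 0 < C ∧ ∀ (α : ℝ), b ≤ α → ∀ (c : ℝ) (k : ℕ),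
      ∑ i ∈ Finset.range (k + 1), Real.exp (-((2 * i - k) * α + c) ^ 2 / 2) ≤ C := by
  have hs := summable_exp_neg_mul_sq (show 0 < b ^ 2 by positivity)
  refine ⟨Real.exp (b ^ 2 / 2) * ∑' z : ℤ, Real.exp (-b ^ 2 * (z : ℝ) ^ 2), ?_, ?_⟩
  · have := hs.tsum_pos (fun _ => (Real.exp_pos _).le) 0 (Real.exp_pos _)
    positivity
  · intro α hα c k
    have hα0 : 0 < α := hb.trans_le hα
    set z : ℝ := (c / α - k) / 2 with hz
    set m : ℤ := round (-z) with hm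
    have h1 : ∀ i : ℕ, Real.exp (-((2 * i - k) * α + c) ^ 2 / 2) ≤
        Real.exp (b ^ 2 / 2) * Real.exp (-b ^ 2 * ((i - m : ℤ) : ℝ) ^ 2) := fun i => by
      rw [← Real.exp_add, Real.exp_le_exp]
      have h2 : (2 * i - k) * α + c = 2 * α * (i + z) := by
        rw [hz]; field_simp; ring
      have h3 := abs_le.1 (abs_sub_round (-z))
      rw [← hm] at h3
      have h4 : ((i : ℝ) - m) ^ 2 ≤ 2 * (i + z) ^ 2 + 1 / 2 := by
        nlinarith [sq_nonneg ((i : ℝ) + z + (-z - m) - 2 * (i + z)), sq_nonneg ((i : ℝ) + z + z + m)]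
      have h5 : b ^ 2 ≤ α ^ 2 := by gcongr
      rw [h2]
      push_cast
      nlinarith [sq_nonneg ((i : ℝ) + z), mul_le_mul_of_nonneg_right h5 (sq_nonneg ((i : ℝ) + z)),
        mul_le_mul_of_nonneg_left h4 (sq_nonneg b)]
    calc _ ≤ ∑ i ∈ Finset.range (k + 1),
          Real.exp (b ^ 2 / 2) * Real.exp (-b ^ 2 * ((i - m : ℤ) : ℝ) ^ 2) :=
          Finset.sum_le_sum fun i _ => h1 i
      _ = Real.exp (b ^ 2 / 2) * ∑ z ∈ (Finset.range (k + 1)).image fun i : ℕ => (i - m : ℤ),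
          Real.exp (-b ^ 2 * (z : ℝ) ^ 2) := by
          rw [← Finset.mul_sum, Finset.sum_image]
          intro i _ j _ hij
          simpa using hij
      _ ≤ _ := by
          gcongr
          exact hs.sum_le_tsum _ fun _ _ => (Real.exp_pos _).le

/-! ### Gaussian averaging -/

section Gaussian

open ProbabilityTheory

variable {E : Type*} [NormedAddCommGroup E] [InnerProductSpace ℝ E]

local notation "⟪" x ", " y "⟫" => inner ℝ x y

/-- The distance from `v` to the line spanned by the unit vector `e`. -/
noncomputable def offLine (e v : E) : ℝ := ‖v - ⟪e, v⟫ • e‖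

lemma norm_smul_add_smul_sq {u v : E} (hu : u ≠ 0) (x y : ℝ) :
    ‖x • u + y • v‖ ^ 2 =
      (x * ‖u‖ + y * ⟪‖u‖⁻¹ • u, v⟫) ^ 2 + (y * offLine (‖u‖⁻¹ • u) v) ^ 2 := by
  set e := ‖u‖⁻¹ • u with he
  have hu' : ‖u‖ ≠ 0 := norm_ne_zero_iff.2 hu
  have he1 : ‖e‖ = 1 := by rw [he, norm_smul, norm_inv, norm_norm, inv_mul_cancel₀ hu']
  have hue : u = ‖u‖ • e := by rw [he, smul_smul, mul_inv_cancel₀ hu', one_smul]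
  clear_value e
  have h1 : x • u + y • v = (x * ‖u‖ + y * ⟪e, v⟫) • e + y • (v - ⟪e, v⟫ • e) := by
    nth_rewrite 1 [hue]
    module
  have h2 : ⟪e, v - ⟪e, v⟫ • e⟫ = 0 := by
    rw [inner_sub_right, real_inner_smul_right, real_inner_self_eq_norm_sq, he1]
    ring
  rw [h1, norm_add_sq_real, real_inner_smul_left, real_inner_smul_right, h2, norm_smul, norm_smul,
    he1, mul_one, mul_pow, Real.norm_eq_abs, Real.norm_eq_abs, sq_abs, sq_abs, offLine, mul_pow]
  ring

/-- In an orthogonal frame with first axis u, for fixed j the first coordinate runs through a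
progression of step 2‖u‖ ≥ 2 whose shift does not matter; the second then has step at least 2ε. -/
lemma exists_sum_sum_exp_neg_norm_sq_le {ε : ℝ} (hε : 0 < ε) :
    ∃ C : ℝ, 0 < C ∧ ∀ u v : E, 1 ≤ ‖u‖ → ε ≤ offLine (‖u‖⁻¹ • u) v → ∀ k : ℕ,
      ∑ j ∈ Finset.range (k + 1), ∑ i ∈ Finset.range (k + 1),
        Real.exp (-‖(2 * i - k : ℝ) • u + (2 * j - k : ℝ) • v‖ ^ 2 / 2) ≤ C := by
  obtain ⟨C₁, h1, h1'⟩ := exists_sum_exp_neg_sq_le one_pos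
  obtain ⟨C₂, h2, h2'⟩ := exists_sum_exp_neg_sq_le hε
  refine ⟨C₂ * C₁, by positivity, fun u v hu hv k => ?_⟩
  have hu0 : u ≠ 0 := norm_pos_iff.1 (one_pos.trans_le hu)
  calc _ ≤ ∑ j ∈ Finset.range (k + 1),
        Real.exp (-((2 * j - k) * offLine (‖u‖⁻¹ • u) v + 0) ^ 2 / 2) * C₁ := by
        refine Finset.sum_le_sum fun j _ => ?_
        refine le_trans (le_of_eq ?_) (mul_le_mul_of_nonneg_left
          (h1' ‖u‖ hu ((2 * j - k) * ⟪‖u‖⁻¹ • u, v⟫) k) (Real.exp_pos _).le)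
        rw [Finset.mul_sum]
        refine Finset.sum_congr rfl fun i _ => ?_
        rw [← Real.exp_add, norm_smul_add_smul_sq hu0]
        congr 1
        ring
    _ ≤ _ := by
        rw [← Finset.sum_mul]
        gcongr
        exact h2' _ hv 0 k

variable [FiniteDimensional ℝ E] [MeasurableSpace E] [BorelSpace E]

lemma integrable_of_abs_le_one {f : E → ℝ} (hf : Continuous f) (h : ∀ x, |f x| ≤ 1) :
    Integrable f (stdGaussian E) :=
  Integrable.of_bound hf.aestronglyMeasurable 1 (Filter.Eventually.of_forall h)

lemma integral_cos_inner (y : E) :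
    ∫ x, Real.cos ⟪y, x⟫ ∂stdGaussian E = Real.exp (-‖y‖ ^ 2 / 2) := by
  have h1 := charFun_stdGaussian y
  rw [charFun_apply] at h1
  have h2 : Integrable (fun x : E => Complex.exp (⟪x, y⟫ * Complex.I)) (stdGaussian E) :=
    Integrable.of_bound (by fun_prop) 1 (Filter.Eventually.of_forall fun x => by
      rw [Complex.norm_exp_ofReal_mul_I])
  have h3 := congrArg Complex.re h1
  rw [← Complex.reCLM_apply, ← ContinuousLinearMap.integral_comp_comm _ h2] at h3
  simp only [Complex.reCLM_apply, Complex.exp_ofReal_mul_I_re] at h3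
  simp only [real_inner_comm y] at h3 ⊢
  rw [h3, ← Complex.exp_ofReal_re]
  push_cast
  rfl

lemma integral_cos_pow_mul_cos_pow (u v : E) (k : ℕ) :
    4 ^ k * ∫ x, Real.cos ⟪u, x⟫ ^ k * Real.cos ⟪v, x⟫ ^ k ∂stdGaussian E =
      ∑ j ∈ Finset.range (k + 1), ∑ i ∈ Finset.range (k + 1), (k.choose j : ℝ) * k.choose i *
        Real.exp (-‖(2 * i - k : ℝ) • u + (2 * j - k : ℝ) • v‖ ^ 2 / 2) := by
  have h1 : ∀ x : E, 4 ^ k * (Real.cos ⟪u, x⟫ ^ k * Real.cos ⟪v, x⟫ ^ k) =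
      ∑ j ∈ Finset.range (k + 1), ∑ i ∈ Finset.range (k + 1), (k.choose j : ℝ) * k.choose i *
        Real.cos ⟪(2 * i - k : ℝ) • u + (2 * j - k : ℝ) • v, x⟫ := fun x => by
    have h2 := two_pow_mul_cos_pow_mul_cos k ⟪v, x⟫ 0
    rw [Real.cos_zero, mul_one] at h2
    calc _ = (2 ^ k * Real.cos ⟪u, x⟫ ^ k) * (2 ^ k * Real.cos ⟪v, x⟫ ^ k) := by
          rw [show (4 : ℝ) = 2 * 2 by norm_num, mul_pow]; ring
      _ = _ := by
          rw [h2, Finset.mul_sum]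
          refine Finset.sum_congr rfl fun j _ => ?_
          rw [add_zero, mul_left_comm, mul_assoc, two_pow_mul_cos_pow_mul_cos, Finset.mul_sum]
          refine Finset.sum_congr rfl fun i _ => ?_
          rw [inner_add_left, real_inner_smul_left, real_inner_smul_left, mul_assoc]
  have h3 : ∀ y : E, Integrable (fun x => Real.cos ⟪y, x⟫) (stdGaussian E) := fun y =>
    integrable_of_abs_le_one (by fun_prop) fun x => Real.abs_cos_le_one _
  rw [← integral_const_mul]
  simp only [h1]
  rw [integral_finsetSum _ fun j _ => integrable_finsetSum _ fun i _ => (h3 _).const_mul _]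
  refine Finset.sum_congr rfl fun j _ => ?_
  rw [integral_finsetSum _ fun i _ => (h3 _).const_mul _]
  refine Finset.sum_congr rfl fun i _ => ?_
  rw [integral_const_mul, integral_cos_inner]

/-- Bounding both binomial weights by the middle coefficient leaves a Gaussian sum over a
well-spaced planar lattice. -/
lemma exists_integral_cos_pow_le {ε : ℝ} (hε : 0 < ε) :
    ∃ C : ℝ, 0 < C ∧ ∀ u v : E, 1 ≤ ‖u‖ → ε ≤ offLine (‖u‖⁻¹ • u) v → ∀ k : ℕ,
      ∫ x, Real.cos ⟪u, x⟫ ^ k * Real.cos ⟪v, x⟫ ^ k ∂stdGaussian E ≤ C * centralProb k ^ 2 := by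
  obtain ⟨C, hC, h⟩ := exists_sum_sum_exp_neg_norm_sq_le (E := E) hε
  refine ⟨C, hC, fun u v hu hv k => ?_⟩
  refine le_of_mul_le_mul_left ?_ (show (0 : ℝ) < 4 ^ k by positivity)
  have hc : ∀ i, k.choose i ≤ k.choose (k / 2) := fun i => Nat.choose_le_middle i k
  rw [integral_cos_pow_mul_cos_pow]
  calc _ ≤ ∑ j ∈ Finset.range (k + 1), ∑ i ∈ Finset.range (k + 1),
        (k.choose (k / 2) : ℝ) * k.choose (k / 2) *
        Real.exp (-‖(2 * i - k : ℝ) • u + (2 * j - k : ℝ) • v‖ ^ 2 / 2) := by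
        gcongr <;> exact hc _
    _ ≤ (k.choose (k / 2) : ℝ) * k.choose (k / 2) * C := by
        simp only [← Finset.mul_sum]
        gcongr
        exact h u v hu hv k
    _ = 4 ^ k * (C * centralProb k ^ 2) := by
        rw [centralProb, show (4 : ℝ) = 2 * 2 by norm_num, mul_pow]
        field_simp

/-- The Gaussian weight is an average of cosines, and the sum of cosines over all signs factors into
a product. -/
lemma sum_exp_neg_norm_signedSum_sub_sq {ι : Type*} [Fintype ι] [DecidableEq ι] (a : ι → E)
    (y : E) : ∑ A : Finset ι, Real.exp (-‖signedSum a A - y‖ ^ 2 / 2) ≤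
      2 ^ Fintype.card ι * ∫ x, ∏ i, |Real.cos ⟪a i, x⟫| ∂stdGaussian E := by
  have h1 : ∀ x : E, ∑ A : Finset ι, Real.cos ⟪signedSum a A - y, x⟫ ≤
      2 ^ Fintype.card ι * ∏ i, |Real.cos ⟪a i, x⟫| := fun x => by
    have h2 := sum_cos_signs (fun i => ⟪a i, x⟫) (-⟪y, x⟫)
    have h3 : ∀ A, ⟪signedSum a A - y, x⟫ = ∑ i, signs A i * ⟪a i, x⟫ + -⟪y, x⟫ := fun A => by
      rw [inner_sub_left, signedSum, sum_inner, sub_eq_add_neg]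
      simp only [real_inner_smul_left]
    simp only [h3, h2]
    rw [← Finset.abs_prod]
    gcongr
    refine (le_abs_self _).trans ?_
    rw [abs_mul]
    exact mul_le_of_le_one_right (abs_nonneg _) (Real.abs_cos_le_one _)
  have h3 : ∀ y : E, Integrable (fun x => Real.cos ⟪y, x⟫) (stdGaussian E) := fun y =>
    integrable_of_abs_le_one (by fun_prop) fun x => Real.abs_cos_le_one _
  simp only [← integral_cos_inner]
  rw [← integral_finsetSum _ fun A _ => h3 _, ← integral_const_mul]
  refine integral_mono (integrable_finsetSum _ fun A _ => h3 _) (Integrable.const_mul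
    (integrable_of_abs_le_one (by fun_prop) fun x => ?_) _) h1
  rw [Finset.abs_prod]
  exact Finset.prod_le_one (fun _ _ => abs_nonneg _) fun i _ => by
    rw [abs_abs]; exact Real.abs_cos_le_one _

lemma prod_le_sum_pow_div {k : ℕ} (hk : k ≠ 0) (z : Fin k → ℝ) (hz : ∀ i, 0 ≤ z i) :
    ∏ i, z i ≤ (∑ i, z i ^ k) / k := by
  have hk' : (k : ℝ) ≠ 0 := Nat.cast_ne_zero.2 hk
  have := Real.geom_mean_le_arith_mean_weighted Finset.univ (fun _ : Fin k => (k : ℝ)⁻¹)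
    (fun i => z i ^ k) (fun _ _ => by positivity) (by simp [hk'])
    (fun i _ => pow_nonneg (hz i) k)
  simp only [Real.pow_rpow_inv_natCast (hz _) hk, ← Finset.mul_sum] at this
  rwa [div_eq_inv_mul]

/-- If there are `2 m` disjoint pairs of vectors spanning parallelograms of height bounded below,
then the signed sums are in a given ball with probability `O(1 / m)`. -/
lemma exists_card_signedSum_mem_closedBall_le (R : ℝ) {ε : ℝ} (hε : 0 < ε) :
    ∃ C : ℝ, 0 < C ∧ ∀ (n m : ℕ) (a : Fin n → E) (f g : Fin (2 * m) → Fin n), m ≠ 0 →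
      Function.Injective (Sum.elim f g) → (∀ i, 1 ≤ ‖a i‖) →
      (∀ j, ε ≤ offLine (‖a (f j)‖⁻¹ • a (f j)) (a (g j))) → ∀ (y : E) (F : Finset (Finset (Fin n))),
      (∀ A ∈ F, signedSum a A ∈ Metric.closedBall y R) → (F.card : ℝ) ≤ 2 ^ n * (C / (2 * m + 1)) := by
  obtain ⟨C, hC, h⟩ := exists_integral_cos_pow_le (E := E) hε
  refine ⟨Real.exp (R ^ 2 / 2) * C, by positivity, fun n m a f g hm hfg ha hfar y F hF => ?_⟩
  have h1 : F.card * Real.exp (-R ^ 2 / 2) ≤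
      ∑ A : Finset (Fin n), Real.exp (-‖signedSum a A - y‖ ^ 2 / 2) := by
    rw [← nsmul_eq_mul]
    refine (Finset.card_nsmul_le_sum F (fun A => Real.exp (-‖signedSum a A - y‖ ^ 2 / 2)) _
      fun A hA => ?_).trans
      (Finset.sum_le_sum_of_subset_of_nonneg (Finset.subset_univ _) fun _ _ _ => (Real.exp_pos _).le)
    have h2 := mem_closedBall_iff_norm.1 (hF A hA)
    have h3 := pow_le_pow_left₀ (norm_nonneg _) h2 2
    -- On the ball the Gaussian weight is at least exp(-R²/2).
    exact Real.exp_le_exp.2 (by linarith)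
  -- AM-GM over the 2m pairs reduces to integrals involving one pair each; the exponent 2m is even,
  -- which removes the absolute values.
  have h2 : ∀ x : E, ∏ i, |Real.cos ⟪a i, x⟫| ≤ (∑ j : Fin (2 * m),
      Real.cos ⟪a (f j), x⟫ ^ (2 * m) * Real.cos ⟪a (g j), x⟫ ^ (2 * m)) / (2 * m : ℕ) := fun x => by
    set w : Fin n → ℝ := fun i => |Real.cos ⟪a i, x⟫| with hw
    have hw0 : ∀ i, 0 ≤ w i := fun i => abs_nonneg _
    calc
      ∏ i, w i ≤ ∏ i ∈ Finset.univ.image (Sum.elim f g), w i :=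
          Finset.prod_le_prod_of_subset_of_le_one (Finset.subset_univ _) (fun i _ => hw0 i)
            fun i _ _ => Real.abs_cos_le_one _
      _ = ∏ j, w (f j) * w (g j) := by
          rw [Finset.prod_image hfg.injOn, Fintype.prod_sum_type, Finset.prod_mul_distrib]
          rfl
      _ ≤ (∑ j, (w (f j) * w (g j)) ^ (2 * m)) / (2 * m : ℕ) :=
          prod_le_sum_pow_div (by omega) _ fun j => mul_nonneg (hw0 _) (hw0 _)
      _ = _ := by
          simp only [mul_pow, hw, (even_two_mul m).pow_abs]
  have h3 : ∀ u v : E, Integrable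
      (fun x => Real.cos ⟪u, x⟫ ^ (2 * m) * Real.cos ⟪v, x⟫ ^ (2 * m)) (stdGaussian E) :=
    fun u v => integrable_of_abs_le_one (by fun_prop) fun x => by
      rw [abs_mul, abs_pow, abs_pow]
      exact mul_le_one₀ (pow_le_one₀ (abs_nonneg _) (Real.abs_cos_le_one _))
        (pow_nonneg (abs_nonneg _) _) (pow_le_one₀ (abs_nonneg _) (Real.abs_cos_le_one _))
  have hm' : (0 : ℝ) < (2 * m : ℕ) := by exact_mod_cast (by omega)
  have h4 : ∫ x, ∏ i, |Real.cos ⟪a i, x⟫| ∂stdGaussian E ≤ C / (2 * m + 1) := by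
    calc _ ≤ ∫ x, (∑ j : Fin (2 * m), Real.cos ⟪a (f j), x⟫ ^ (2 * m) *
          Real.cos ⟪a (g j), x⟫ ^ (2 * m)) / (2 * m : ℕ) ∂stdGaussian E := by
          refine integral_mono (integrable_of_abs_le_one (by fun_prop) fun x => ?_)
            ((integrable_finsetSum _ fun j _ => h3 _ _).div_const _) h2
          rw [Finset.abs_prod]
          exact Finset.prod_le_one (fun _ _ => abs_nonneg _) fun i _ => by
            rw [abs_abs]; exact Real.abs_cos_le_one _
      _ ≤ (∑ j : Fin (2 * m), C * centralProb (2 * m) ^ 2) / (2 * m : ℕ) := by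
          rw [integral_div, integral_finsetSum _ fun j _ => h3 _ _]
          gcongr with j
          exact h _ _ (ha _) (hfar j) _
      _ = C * centralProb (2 * m) ^ 2 := by
          rw [Finset.sum_const, Finset.card_univ, Fintype.card_fin, nsmul_eq_mul]
          field_simp
      _ ≤ C / (2 * m + 1) := by
          rw [centralProb_eq, show (2 * m + 1) / 2 = m by omega, div_eq_mul_one_div C]
          gcongr
          exact sq_centralBinom_div_le m
  have h5 := h1.trans (sum_exp_neg_norm_signedSum_sub_sq a y)
  rw [Fintype.card_fin, neg_div, Real.exp_neg, ← div_eq_mul_inv, div_le_iff₀ (Real.exp_pos _)] at h5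
  calc (F.card : ℝ) ≤ _ := h5
    _ ≤ 2 ^ n * (C / (2 * m + 1)) * Real.exp (R ^ 2 / 2) := by gcongr
    _ = _ := by ring

end Gaussian

/-! ### Vectors close to a line -/

/-- Greedy choice: k pairs use at most 2k < K indices, so a fresh i remains, and so does a fresh
partner far from it. -/
lemma exists_disjoint_pairs {n K : ℕ} (far : Fin n → Fin n → Prop) [∀ i, DecidablePred (far i)]
    (hirr : ∀ i, ¬ far i i) (hK : ∀ i, K ≤ (Finset.univ.filter (far i)).card) (hn : K ≤ n) (k : ℕ)
    (hk : 2 * k ≤ K) : ∃ f g : Fin k → Fin n,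
      Function.Injective (Sum.elim f g) ∧ ∀ j, far (f j) (g j) := by
  induction k with
  | zero => exact ⟨Fin.elim0, Fin.elim0, Function.injective_of_subsingleton _, fun j => j.elim0⟩
  | succ k ih =>
    obtain ⟨f, g, hfg, hfar⟩ := ih (by omega)
    set used := Finset.univ.image (Sum.elim f g) with hused
    have hcard : used.card ≤ 2 * k := Finset.card_image_le.trans (by simp; omega)
    obtain ⟨i, -, hi⟩ := Finset.exists_mem_notMem_of_card_lt_card
      (s := used) (t := Finset.univ) (by rw [Finset.card_univ, Fintype.card_fin]; omega)
    obtain ⟨j, hj, hj'⟩ := Finset.exists_mem_notMem_of_card_lt_card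
      (s := used) (t := Finset.univ.filter (far i)) (by have := hK i; omega)
    have hij : far i j := (Finset.mem_filter.1 hj).2
    have hne : i ≠ j := by rintro rfl; exact hirr _ hij
    have hmem : ∀ c, Sum.elim f g c ∈ used := fun c => Finset.mem_image_of_mem _ (Finset.mem_univ c)
    have hf : ∀ c, f c ∈ used := fun c => hmem (Sum.inl c)
    have hg : ∀ c, g c ∈ used := fun c => hmem (Sum.inr c)
    refine ⟨Fin.cons i f, Fin.cons j g, ?_, fun c => ?_⟩
    · refine Function.Injective.sumElim (Fin.cons_injective_iff.2 ⟨?_, ?_⟩)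
        (Fin.cons_injective_iff.2 ⟨?_, ?_⟩) fun c c' => ?_
      · rintro ⟨c, rfl⟩; exact hi (hf c)
      · exact fun c c' h => Sum.inl_injective (hfg (by simpa using h))
      · rintro ⟨c, rfl⟩; exact hj' (hg c)
      · exact fun c c' h => Sum.inr_injective (hfg (by simpa using h))
      · induction c using Fin.cases with
        | zero =>
          induction c' using Fin.cases with
          | zero => simpa using hne
          | succ c' => simpa using fun h : i = g c' => hi (h ▸ hg c')
        | succ c =>
          induction c' using Fin.cases with
          | zero => simpa using fun h : f c = j => hj' (h ▸ hf c)
          | succ c' => simpa using fun h : f c = g c' =>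
              Sum.inl_ne_inr (hfg (a₁ := Sum.inl c) (a₂ := Sum.inr c') (by simpa using h))
    · induction c using Fin.cases with
      | zero => simpa using hij
      | succ c => simpa using hfar c

section Geometry

variable {E : Type*} [NormedAddCommGroup E] [InnerProductSpace ℝ E]

local notation "⟪" x ", " y "⟫" => inner ℝ x y

lemma one_sub_le_inner_of_offLine_le {e v : E} {ε : ℝ} (he : ‖e‖ = 1) (hv : 1 ≤ ‖v‖)
    (hoff : offLine e v ≤ ε) (h0 : 0 ≤ ⟪e, v⟫) : 1 - ε ≤ ⟪e, v⟫ := by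
  have h1 := norm_add_le (v - ⟪e, v⟫ • e) (⟪e, v⟫ • e)
  rw [sub_add_cancel, norm_smul, he, mul_one, Real.norm_of_nonneg h0] at h1
  unfold offLine at hoff
  linarith

lemma inner_le_norm_of_unit {e : E} (he : ‖e‖ = 1) (v : E) : ⟪e, v⟫ ≤ ‖v‖ := by
  have := real_inner_le_norm e v
  rwa [he, one_mul] at this

lemma norm_smul_add_sq {e : E} (he : ‖e‖ = 1) (x : ℝ) (v : E) :
    ‖x • e + v‖ ^ 2 = x ^ 2 + 2 * x * ⟪e, v⟫ + ‖v‖ ^ 2 := by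
  rw [norm_add_sq_real, norm_smul, he, mul_one, Real.norm_eq_abs, sq_abs, real_inner_smul_left]
  ring

variable {ι : Type*} {e : E} {a : ι → E} {D : Finset ι} {ε : ℝ}

lemma card_mul_le_inner_sum {c : ℝ} (h : ∀ i ∈ D, c ≤ ⟪e, a i⟫) :
    D.card * c ≤ ⟪e, ∑ i ∈ D, a i⟫ := by
  rw [inner_sum, ← nsmul_eq_mul]
  exact Finset.card_nsmul_le_sum _ _ _ h

lemma norm_inner_smul_add_le (hoff : ∀ i ∈ D, offLine e (a i) ≤ ε) (v : E) :
    ‖⟪e, ∑ i ∈ D, a i⟫ • e + v‖ ≤ ‖∑ i ∈ D, a i + v‖ + D.card * ε := by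
  have h1 : ‖∑ i ∈ D, (a i - ⟪e, a i⟫ • e)‖ ≤ D.card * ε := by
    rw [← nsmul_eq_mul]
    exact (norm_sum_le _ _).trans (Finset.sum_le_card_nsmul _ _ _ hoff)
  have h2 : ⟪e, ∑ i ∈ D, a i⟫ • e + v =
      (∑ i ∈ D, a i + v) - ∑ i ∈ D, (a i - ⟪e, a i⟫ • e) := by
    rw [inner_sum, Finset.sum_sub_distrib, Finset.sum_smul]
    abel
  rw [h2]
  exact (norm_sub_le _ _).trans (by linarith)

variable {R : ℝ} {s : ℕ}

lemma lt_norm_sum_of_le_card (he : ‖e‖ = 1) (hD : ∀ i ∈ D, 1 - ε ≤ ⟪e, a i⟫) (hε : ε < 1)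
    (h : R < s * (1 - ε)) (hs : s ≤ D.card) : R < ‖∑ i ∈ D, a i‖ := by
  have h1 : (s : ℝ) ≤ D.card := by exact_mod_cast hs
  have h2 := card_mul_le_inner_sum hD
  have h3 := inner_le_norm_of_unit he (∑ i ∈ D, a i)
  nlinarith

/-- With s near vectors the components along e suffice. With exactly s - 1, projecting their sum to
ℝe costs at most (s-1)ε, and the cross term with v is nonnegative. -/
lemma lt_norm_sum_add_of_le_card (he : ‖e‖ = 1) (hD : ∀ i ∈ D, 1 - ε ≤ ⟪e, a i⟫)
    (hoff : ∀ i ∈ D, offLine e (a i) ≤ ε) (hε : ε < 1) (h : R < s * (1 - ε)) (hs1 : 1 ≤ s)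
    (h' : (R + ((s : ℝ) - 1) * ε) ^ 2 < (((s : ℝ) - 1) * (1 - ε)) ^ 2 + 1) {v : E} (hv : 1 ≤ ‖v‖)
    (hv0 : 0 ≤ ⟪e, v⟫) (hs : s - 1 ≤ D.card) : R < ‖∑ i ∈ D, a i + v‖ := by
  have h2 := card_mul_le_inner_sum hD
  rcases hs.lt_or_eq with hs | hs
  · have h1 : (s : ℝ) ≤ D.card := by exact_mod_cast (by omega : s ≤ D.card)
    have h3 := inner_le_norm_of_unit he (∑ i ∈ D, a i + v)
    rw [inner_add_right] at h3
    nlinarith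
  · have h1 : (D.card : ℝ) = s - 1 := by rw [← hs, Nat.cast_sub hs1, Nat.cast_one]
    have h3 := norm_inner_smul_add_le hoff v
    have h4 := norm_smul_add_sq he ⟪e, ∑ i ∈ D, a i⟫ v
    rw [h1] at h2 h3
    have h5 : (0 : ℝ) ≤ (s - 1) * (1 - ε) :=
      mul_nonneg (by rw [← h1]; positivity) (by linarith)
    have h6 : (R + ((s : ℝ) - 1) * ε) ^ 2 < ‖⟪e, ∑ i ∈ D, a i⟫ • e + v‖ ^ 2 := by
      rw [h4]
      nlinarith [mul_nonneg (h5.trans h2) hv0, pow_le_pow_left₀ h5 h2 2]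
    have h7 := lt_of_pow_lt_pow_left₀ 2 (norm_nonneg _) h6
    linarith

/-- With s + 1 near vectors the components along e suffice. With exactly s, the squared norm after
projection is at least t² - 2tτ + 1, which increases for t ≥ τ. -/
lemma lt_norm_sum_sub_of_le_card {τ : ℝ} (he : ‖e‖ = 1) (hD : ∀ i ∈ D, 1 - ε ≤ ⟪e, a i⟫)
    (hoff : ∀ i ∈ D, offLine e (a i) ≤ ε) (hε : ε < 1) (hs1 : 1 ≤ s)
    (hτ : τ < 1 - ε) (h : R < (s + 1) * (1 - ε) - τ)
    (h' : (R + s * ε) ^ 2 < (s * (1 - ε)) ^ 2 - 2 * (s * (1 - ε)) * τ + 1) {v : E} (hv : 1 ≤ ‖v‖)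
    (hvτ : ⟪e, v⟫ ≤ τ) (hs : s ≤ D.card) : R < ‖∑ i ∈ D, a i - v‖ := by
  have h2 := card_mul_le_inner_sum hD
  rcases hs.lt_or_eq with hs | hs
  · have h1 : (s : ℝ) + 1 ≤ D.card := by exact_mod_cast hs
    have h3 := inner_le_norm_of_unit he (∑ i ∈ D, a i - v)
    rw [inner_sub_right] at h3
    nlinarith
  · have h3 := norm_inner_smul_add_le hoff (-v)
    have h4 := norm_smul_add_sq he ⟪e, ∑ i ∈ D, a i⟫ (-v)
    rw [← hs] at h2 h3
    rw [norm_neg, inner_neg_right] at h4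
    have hs1' : (1 : ℝ) ≤ s := by exact_mod_cast hs1
    have h5 : τ ≤ s * (1 - ε) := by nlinarith
    have h5' : 0 ≤ s * (1 - ε) := mul_nonneg (by positivity) (by linarith)
    have h6 : (R + s * ε) ^ 2 < ‖⟪e, ∑ i ∈ D, a i⟫ • e + -v‖ ^ 2 := by
      rw [h4]
      nlinarith [mul_nonneg (h5'.trans h2) (sub_nonneg.2 hvτ),
        mul_nonneg (sub_nonneg.2 h2) (sub_nonneg.2 (h5.trans h2)),
        mul_nonneg (sub_nonneg.2 h2) (sub_nonneg.2 h5)]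
    have h7 := lt_of_pow_lt_pow_left₀ 2 (norm_nonneg _) h6
    rw [sub_eq_add_neg]
    linarith

end Geometry

/-- Thresholds separating the vectors almost parallel to a line from the exceptional ones. -/
lemma exists_thresholds {R : ℝ} {s : ℕ} (hs : 1 ≤ s) (hsR : (s : ℝ) - 1 ≤ R)
    (hRs : R < Real.sqrt (((s : ℝ) - 1) ^ 2 + 1)) :
    ∃ τ ε : ℝ, R ≤ (max s 2 : ℕ) * τ ∧ 0 < ε ∧ ε < 1 ∧ R < s * (1 - ε) ∧ τ < 1 - ε ∧
      R < (s + 1) * (1 - ε) - τ ∧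
      (R + ((s : ℝ) - 1) * ε) ^ 2 < (((s : ℝ) - 1) * (1 - ε)) ^ 2 + 1 ∧
      (R + s * ε) ^ 2 < (s * (1 - ε)) ^ 2 - 2 * (s * (1 - ε)) * τ + 1 := by
  have hs1 : (1 : ℝ) ≤ s := by exact_mod_cast hs
  have hR0 : 0 ≤ R := by linarith
  have hR2 : R ^ 2 < ((s : ℝ) - 1) ^ 2 + 1 := by
    rwa [Real.lt_sqrt hR0] at hRs
  have hRs' : R < s := by nlinarith
  -- The system at ε = 0. For s ≥ 2 the least admissible τ = R/s works: the last inequality reads R²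
  -- + 2R < s² + 1, which follows from `hR2` and R ≤ s - 1/2.
  obtain ⟨τ, h1, h2, h3, h4⟩ : ∃ τ : ℝ, R ≤ (max s 2 : ℕ) * τ ∧ τ < 1 ∧ R < s + 1 - τ ∧
      R ^ 2 < (s : ℝ) ^ 2 - 2 * s * τ + 1 := by
    rcases hs.eq_or_lt with rfl | hs2
    · refine ⟨1 / 2, ?_⟩
      norm_num at hR2 hRs' ⊢
      exact ⟨hRs'.le, by linarith, by nlinarith⟩
    · have hs2' : (2 : ℝ) ≤ s := by exact_mod_cast hs2
      have hτ : (s : ℝ) * (R / s) = R := by field_simp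
      have hτ1 : R / s < 1 := (div_lt_one (by linarith)).2 hRs'
      refine ⟨R / s, ?_, hτ1, by linarith, ?_⟩
      · rw [max_eq_left hs2, hτ]
      · have : R ≤ s - 1 / 2 := by nlinarith
        rw [mul_assoc, hτ]
        nlinarith
  -- Strict inequalities at ε = 0 persist for small ε > 0.
  have key : ∀ f g : ℝ → ℝ, Continuous f → Continuous g → f 0 < g 0 →
      ∀ᶠ ε in nhdsWithin (0 : ℝ) (Set.Ioi 0), f ε < g ε := fun f g hf hg h =>
    (hf.continuousAt.eventually_lt hg.continuousAt h).filter_mono nhdsWithin_le_nhds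
  have hev := (key (fun ε => ε) (fun _ => 1) (by fun_prop) (by fun_prop) (by norm_num)).and <|
    (key (fun _ => R) (fun ε => s * (1 - ε)) (by fun_prop) (by fun_prop) (by simpa)).and <|
    (key (fun _ => τ) (fun ε => 1 - ε) (by fun_prop) (by fun_prop) (by simpa)).and <|
    (key (fun _ => R) (fun ε => (s + 1) * (1 - ε) - τ) (by fun_prop) (by fun_prop)
      (by simpa)).and <|
    (key (fun ε => (R + ((s : ℝ) - 1) * ε) ^ 2) (fun ε => (((s : ℝ) - 1) * (1 - ε)) ^ 2 + 1)
      (by fun_prop) (by fun_prop) (by simpa)).and <|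
    key (fun ε => (R + s * ε) ^ 2) (fun ε => (s * (1 - ε)) ^ 2 - 2 * (s * (1 - ε)) * τ + 1)
      (by fun_prop) (by fun_prop) (by simpa)
  obtain ⟨ε, ⟨h5, h6, h7, h8, h9, h10⟩, hε⟩ := (hev.and self_mem_nhdsWithin).exists
  exact ⟨τ, ε, h1, hε, h5, h6, h7, h8, h9, h10⟩

open Classical in
/-- A family of sets in which chains inside `G` are short, and two such chains differing by an
exceptional element `i₀` cannot both be as long as possible. -/
lemma card_le_of_exceptional {n s : ℕ} (hs : 1 ≤ s) (F : Finset (Finset (Fin n)))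
    (G : Finset (Fin n)) {i₀ : Fin n} (hi₀ : i₀ ∉ G)
    (h₁ : ∀ A ∈ F, ∀ B ∈ F, A ⊆ B → B \ A ⊆ G → (B \ A).card < s)
    (h₂ : ∀ A B, A ⊆ B → B \ A ⊆ G → i₀ ∉ B → A ∈ F → insert i₀ B ∈ F → (B \ A).card < s - 1)
    (h₃ : ∀ A B, A ⊆ B → B \ A ⊆ G → i₀ ∉ B → insert i₀ A ∈ F → B ∈ F → (B \ A).card < s) :
    F.card ≤ 2 ^ (n - G.card - 1) * ((2 * s - 1) * G.card.choose (G.card / 2)) := by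
  set H := (insert i₀ G)ᶜ with hH
  have hHc : H.card = n - G.card - 1 := by
    rw [hH, Finset.card_compl, Finset.card_insert_of_notMem hi₀, Fintype.card_fin]
    omega
  rw [← hHc, ← Finset.card_powerset, ← smul_eq_mul (_ : ℕ)]
  -- Fixing the trace on H fixes all signs off G and i₀. Each fibre is a pair of families of subsets
  -- of G, without and with i₀.
  rw [Finset.card_eq_sum_card_fiberwise (f := fun A => A ∩ H) (t := H.powerset)
    fun A _ => Finset.mem_coe.2 (Finset.mem_powerset.2 Finset.inter_subset_right)]
  refine Finset.sum_le_card_nsmul _ _ _ fun B hB => ?_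
  rw [Finset.mem_powerset] at hB
  let up : Finset G → Finset (Fin n) := fun A => A.map (Function.Embedding.subtype _) ∪ B
  have hi₀up : ∀ A, i₀ ∉ up A := fun A => by
    simp only [up, Finset.mem_union, Finset.mem_map, not_or, not_exists]
    refine ⟨fun x hx => hi₀ (hx.2 ▸ x.2), fun h => ?_⟩
    have := hB h
    rw [hH, Finset.mem_compl] at this
    exact this (Finset.mem_insert_self _ _)
  have hup_mono : ∀ {A A' : Finset G}, A ⊆ A' → up A ⊆ up A' := fun h =>
    Finset.union_subset_union_left (Finset.map_subset_map.2 h)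
  have hup_sdiff : ∀ A A' : Finset G, up A' \ up A = (A' \ A).map (Function.Embedding.subtype _) := by
    intro A A'
    ext x
    have : x ∈ B → x ∉ G := fun h hx => by
      have := hB h
      rw [hH, Finset.mem_compl] at this
      exact this (Finset.mem_insert_of_mem hx)
    simp only [up, Finset.mem_sdiff, Finset.mem_union, Finset.mem_map,
      Function.Embedding.subtype_apply, Subtype.exists, exists_and_right, exists_eq_right]
    grind
  have hup_subset : ∀ A A' : Finset G, up A' \ up A ⊆ G := fun A A' x hx => by
    rw [hup_sdiff, Finset.mem_map] at hx
    obtain ⟨y, -, rfl⟩ := hx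
    exact y.2
  have hsurj : ∀ A : Finset (Fin n), A ∩ H = B → A.erase i₀ = up (A.subtype (· ∈ G)) := by
    intro A hA
    ext x
    have : x ∈ B ↔ x ∈ A ∧ x ≠ i₀ ∧ x ∉ G := by
      rw [← hA, hH]; simp
    have hx : x ∈ G → x ≠ i₀ := fun h h' => hi₀ (h' ▸ h)
    simp only [up, Finset.mem_erase, Finset.subtype_map, Finset.mem_union, Finset.mem_filter, this]
    tauto
  have hsum := sum_le_mul_choose_middle
    (fun A : Finset G => (if up A ∈ F then 1 else 0) + (if insert i₀ (up A) ∈ F then 1 else 0))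
    (2 * s - 1) fun f => by
      rw [Finset.sum_add_distrib, ← Finset.card_filter, ← Finset.card_filter]
      have hcard : ∀ {k l : ℕ}, k ≤ l → l ≤ Fintype.card G →
          (up (initSeg f l) \ up (initSeg f k)).card = l - k := fun h hl => by
        rw [hup_sdiff, Finset.card_map, card_initSeg_sdiff f h hl]
      refine card_add_card_lt_two_mul hs ?_ ?_ ?_ ?_ <;> intro k hk l hl <;>
        simp only [Finset.mem_filter, Finset.mem_range] at hk hl <;> by_contra! hkl
      · have := h₁ _ hk.2 _ hl.2 (hup_mono (initSeg_mono f (by omega))) (hup_subset _ _)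
        rw [hcard (by omega) (by omega)] at this
        omega
      · have hsd : insert i₀ (up (initSeg f l)) \ insert i₀ (up (initSeg f k)) =
            up (initSeg f l) \ up (initSeg f k) := by
          rw [Finset.insert_sdiff_insert, Finset.sdiff_insert_of_notMem (hi₀up _)]
        have := h₁ _ hk.2 _ hl.2
          (Finset.insert_subset_insert _ (hup_mono (initSeg_mono f (by omega))))
          (hsd ▸ hup_subset _ _)
        rw [hsd, hcard (by omega) (by omega)] at this
        omega
      · have := h₂ _ _ (hup_mono (initSeg_mono f (by omega))) (hup_subset _ _) (hi₀up _) hk.2 hl.2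
        rw [hcard (by omega) (by omega)] at this
        omega
      · have := h₃ _ _ (hup_mono (initSeg_mono f (by omega))) (hup_subset _ _) (hi₀up _) hk.2 hl.2
        rw [hcard (by omega) (by omega)] at this
        omega
  rw [Fintype.card_coe] at hsum
  refine le_trans ?_ (by exact_mod_cast hsum)
  rw [Finset.sum_add_distrib, ← Finset.card_filter, ← Finset.card_filter,
    ← Finset.card_filter_add_card_filter_not (fun A => i₀ ∉ A)]
  refine add_le_add (le_trans (Finset.card_le_card ?_) (Finset.card_image_le (f := up)))
    (le_trans (Finset.card_le_card ?_) (Finset.card_image_le (f := fun A => insert i₀ (up A))))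
  · intro A hA
    simp only [Finset.mem_filter] at hA
    have h := hsurj A hA.1.2
    rw [Finset.erase_eq_of_notMem hA.2] at h
    exact Finset.mem_image.2 ⟨_, Finset.mem_filter.2 ⟨Finset.mem_univ _, h ▸ hA.1.1⟩, h.symm⟩
  · intro A hA
    simp only [Finset.mem_filter, not_not] at hA
    have h : insert i₀ (up (A.subtype (· ∈ G))) = A := by
      rw [← hsurj A hA.1.2, Finset.insert_erase hA.2]
    refine Finset.mem_image.2 ⟨_, Finset.mem_filter.2 ⟨Finset.mem_univ _, ?_⟩, h⟩
    rw [h]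
    exact hA.1.1

/-! ### The sharp upper bound -/

section UpperBound

variable {E : Type*} [NormedAddCommGroup E] [InnerProductSpace ℝ E]

local notation "⟪" x ", " y "⟫" => inner ℝ x y

lemma norm_signedSum_sub_le {n : ℕ} {a : Fin n → E} {y : E} {R : ℝ} {A B : Finset (Fin n)}
    (hA : signedSum a A ∈ Metric.closedBall y R) (hB : signedSum a B ∈ Metric.closedBall y R) :
    ‖signedSum a B - signedSum a A‖ ≤ 2 * R := by
  rw [mem_closedBall_iff_norm] at hA hB
  calc _ = ‖(signedSum a B - y) - (signedSum a A - y)‖ := by rw [sub_sub_sub_cancel_right]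
    _ ≤ _ := (norm_sub_le _ _).trans (by linarith)

lemma norm_le_of_two_smul {v : E} {R : ℝ} (h : ‖(2 : ℝ) • v‖ ≤ 2 * R) : ‖v‖ ≤ R := by
  rw [norm_smul, Real.norm_two] at h
  linarith

open Classical in
/-- Given vectors with nonnegative components along `e`, either none of them is exceptional and
Erdős' bound holds, or there is an exceptional vector and the bound improves. -/
lemma card_le_S_or_card_le {n s : ℕ} {R τ ε : ℝ} (hs : 1 ≤ s) (hn : s ≤ n + 1) (hR : R < 1 ∨ 2 ≤ s)
    (hτ : R ≤ (max s 2 : ℕ) * τ) (hε : ε < 1) (h1 : R < s * (1 - ε))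
    (h2 : τ < 1 - ε) (h3 : R < (s + 1) * (1 - ε) - τ)
    (h4 : (R + ((s : ℝ) - 1) * ε) ^ 2 < (((s : ℝ) - 1) * (1 - ε)) ^ 2 + 1)
    (h5 : (R + s * ε) ^ 2 < (s * (1 - ε)) ^ 2 - 2 * (s * (1 - ε)) * τ + 1)
    (hτ0 : 0 ≤ τ) {e : E} (he : ‖e‖ = 1) {a : Fin n → E} (ha : ∀ i, 1 ≤ ‖a i‖)
    (ha0 : ∀ i, 0 ≤ ⟪e, a i⟫) (y : E) (F : Finset (Finset (Fin n)))
    (hF : ∀ A ∈ F, signedSum a A ∈ Metric.closedBall y R) (G : Finset (Fin n))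
    (hG : ∀ i ∈ G, offLine e (a i) ≤ ε) :
    F.card ≤ S n s ∨
      G.card < n ∧ F.card ≤ 2 ^ (n - G.card - 1) * ((2 * s - 1) * G.card.choose (G.card / 2)) := by
  have hdiff : ∀ A ∈ F, ∀ B ∈ F, A ⊆ B → ‖∑ i ∈ B \ A, a i‖ ≤ R := fun A hA B hB hAB => by
    have := norm_signedSum_sub_le (hF A hA) (hF B hB)
    rw [signedSum_sub_signedSum a hAB] at this
    exact norm_le_of_two_smul this
  have hin : ∀ {D : Finset (Fin n)}, D ⊆ G → ∀ i ∈ D, 1 - ε ≤ ⟪e, a i⟫ := fun hD i hi =>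
    one_sub_le_inner_of_offLine_le he (ha i) (hG i (hD hi)) (ha0 i)
  -- Such an i₀ is automatically outside G, where components are at least 1 - ε > τ.
  by_cases hex : ∃ i₀, ⟪e, a i₀⟫ ≤ τ
  · obtain ⟨i₀, hi₀⟩ := hex
    have hi₀G : i₀ ∉ G := fun h => by
      have := hin subset_rfl i₀ h
      linarith
    refine Or.inr ⟨?_, card_le_of_exceptional hs F G hi₀G ?_ ?_ ?_⟩
    · have := Finset.card_lt_univ_of_notMem hi₀G
      rwa [Fintype.card_fin] at this
    · intro A hA B hB hAB hsub
      by_contra! hc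
      exact (lt_norm_sum_of_le_card he (hin hsub) hε h1 hc).not_ge (hdiff A hA B hB hAB)
    · intro A B hAB hsub hi₀B hA hB
      by_contra! hc
      have hd := hdiff A hA _ hB (hAB.trans (Finset.subset_insert _ _))
      rw [Finset.insert_sdiff_of_notMem _ (fun h => hi₀B (hAB h)), Finset.sum_insert
        (fun h => hi₀B (Finset.mem_sdiff.1 h).1), add_comm] at hd
      exact (lt_norm_sum_add_of_le_card he (hin hsub) (fun i hi => hG i (hsub hi)) hε h1 hs h4
        (ha i₀) (ha0 i₀) hc).not_ge hd
    · intro A B hAB hsub hi₀B hA hB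
      by_contra! hc
      have hi₀A : i₀ ∉ A := fun h => hi₀B (hAB h)
      have hd := norm_signedSum_sub_le (hF _ hA) (hF _ hB)
      have hd1 := signedSum_sub_signedSum a hAB
      have hd2 := signedSum_sub_signedSum a (Finset.subset_insert i₀ A)
      rw [Finset.insert_sdiff_cancel hi₀A, Finset.sum_singleton] at hd2
      have hd3 : signedSum a B - signedSum a (insert i₀ A) =
          (2 : ℝ) • (∑ i ∈ B \ A, a i - a i₀) := by
        rw [smul_sub, ← hd1, ← hd2]
        abel
      rw [hd3] at hd
      exact (lt_norm_sum_sub_of_le_card he (hin hsub) (fun i hi => hG i (hsub hi)) hε hs h2 h3 h5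
        (ha i₀) hi₀ hc).not_ge (norm_le_of_two_smul hd)
  · push Not at hex
    refine Or.inl (card_le_S_of_forall_card_sdiff_lt hs hn F fun A hA B hB hAB => ?_)
    by_contra! hc
    have hd := hdiff A hA B hB hAB
    -- Below `max s 2` only s = 1 with a gap of one element occurs, and a single vector has norm at
    -- least 1 > R.
    rcases lt_or_ge (B \ A).card (max s 2) with hlt | hge
    · have hc1 : (B \ A).card = 1 := by omega
      obtain ⟨i, hi⟩ := Finset.card_eq_one.1 hc1
      rw [hi, Finset.sum_singleton] at hd
      have := ha i
      rcases hR with hR | hR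
      · linarith
      · omega
    · have hne : (B \ A).Nonempty := Finset.card_pos.1 (by omega)
      have hlt : ((B \ A).card : ℝ) * τ < ⟪e, ∑ i ∈ B \ A, a i⟫ := by
        rw [inner_sum, ← nsmul_eq_mul, ← Finset.sum_const]
        exact Finset.sum_lt_sum_of_nonempty hne fun i _ => hex i
      have hge' : ((max s 2 : ℕ) : ℝ) ≤ (B \ A).card := by exact_mod_cast hge
      have := inner_le_norm_of_unit he (∑ i ∈ B \ A, a i)
      nlinarith

/-- Passing from n to N costs at most the factor √((n+1)/N), which is smaller than (s - 1/4)/(s -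
1/2) > 1 + 1/(4s). -/
lemma mul_centralProb_le {s n N : ℕ} (hs : 1 ≤ s) (hn : 8 * s ≤ n) (hN : N ≤ n)
    (h : (8 * s - 1) * n ≤ 8 * s * (N : ℝ)) :
    ((s : ℝ) - 1 / 2) * centralProb N ≤ (s - 1 / 4) * centralProb n := by
  have hs' : (1 : ℝ) ≤ s := by exact_mod_cast hs
  have hn' : 8 * (s : ℝ) ≤ n := by exact_mod_cast hn
  have hN0 : (0 : ℝ) < N := by
    have : 0 < (8 * s - 1) * (n : ℝ) := mul_pos (by linarith) (by linarith)
    by_contra! hc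
    nlinarith
  have h1 := mul_sq_centralProb_le hN
  have h2 : ((s : ℝ) - 1 / 2) ^ 2 * (n + 1) ≤ (s - 1 / 4) ^ 2 * N := by
    refine le_of_mul_le_mul_left ?_ (show 0 < 8 * (s : ℝ) by linarith)
    calc 8 * (s : ℝ) * (((s : ℝ) - 1 / 2) ^ 2 * (n + 1))
        ≤ ((s : ℝ) - 1 / 4) ^ 2 * ((8 * s - 1) * n) := by
          have h3 : (s : ℝ) ^ 2 ≤ 3 * s ^ 2 - s - 1 / 16 := by nlinarith
          have h4 : (s : ℝ) ^ 2 * (8 * s) ≤ (3 * s ^ 2 - s - 1 / 16) * n := by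
            gcongr
            nlinarith
          nlinarith
      _ ≤ ((s : ℝ) - 1 / 4) ^ 2 * (8 * s * N) := by gcongr
      _ = _ := by ring
  have h5 := centralProb_pos n
  refine (le_abs_self _).trans (abs_le_of_sq_le_sq ?_ (mul_nonneg (by linarith) h5.le))
  refine le_of_mul_le_mul_left ?_ hN0
  calc (N : ℝ) * (((s : ℝ) - 1 / 2) * centralProb N) ^ 2
      = ((s : ℝ) - 1 / 2) ^ 2 * (N * centralProb N ^ 2) := by ring
    _ ≤ ((s : ℝ) - 1 / 2) ^ 2 * ((n + 1) * centralProb n ^ 2) := by gcongr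
    _ = (((s : ℝ) - 1 / 2) ^ 2 * (n + 1)) * centralProb n ^ 2 := by ring
    _ ≤ (((s : ℝ) - 1 / 4) ^ 2 * N) * centralProb n ^ 2 := by gcongr
    _ = _ := by ring

/-- Order 1/n against order n^(-1/2); the constant 3/4 is the least value of s - 1/4. -/
lemma eventually_div_le_centralProb {s : ℕ} (hs : 1 ≤ s) {C : ℝ} (hC : 0 < C) :
    ∀ᶠ n : ℕ in Filter.atTop,
      C / (2 * ((n / (8 * s) + 1) / 4 : ℕ) + 1) ≤ 3 / 4 * centralProb n := by
  obtain ⟨M, hM⟩ := exists_nat_gt (8 * (32 * C * s) ^ 2)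
  filter_upwards [Filter.eventually_ge_atTop (32 * s), Filter.eventually_ge_atTop (2 * M + 1)]
    with n hn hnM
  have hs' : (1 : ℝ) ≤ s := by exact_mod_cast hs
  have hn' : 32 * (s : ℝ) ≤ n := by exact_mod_cast hn
  have hn0 : (0 : ℝ) < n := by linarith
  set m := (n / (8 * s) + 1) / 4 with hm
  have h1 : (n : ℝ) / (32 * s) ≤ 2 * m + 1 := by
    rw [div_le_iff₀ (by linarith)]
    have h2 : n < 8 * s * (n / (8 * s) + 1) := Nat.lt_mul_div_succ n (by omega)
    have h3 : n / (8 * s) + 1 ≤ 4 * m + 3 := by omega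
    have h4 : n ≤ 8 * s * (4 * m + 3) := h2.le.trans (Nat.mul_le_mul_left _ h3)
    have h5 : (n : ℝ) ≤ 8 * s * (4 * m + 3) := by exact_mod_cast h4
    nlinarith
  have h6 : C / (2 * m + 1) ≤ 32 * C * s / n := by
    rw [div_le_div_iff₀ (by positivity) hn0]
    rw [div_le_iff₀ (by linarith)] at h1
    nlinarith
  refine h6.trans ?_
  have h7 := one_le_mul_sq_centralProb (show 1 ≤ n by omega)
  have h8 := centralProb_pos n
  refine (le_abs_self _).trans (abs_le_of_sq_le_sq ?_ (by linarith))
  rw [div_pow, div_le_iff₀ (by positivity)]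
  have h9 : 2 * (M : ℝ) + 1 ≤ n := by exact_mod_cast hnM
  have h10 : 8 * (32 * C * s) ^ 2 * (n + 1) ≤ n ^ 2 := by
    nlinarith [sq_nonneg (32 * C * s)]
  have h11 : (0 : ℝ) < 8 * (n + 1) := by linarith
  refine le_of_mul_le_mul_left ?_ h11
  nlinarith [mul_le_mul_of_nonneg_right h7 (sq_nonneg (n : ℝ))]

lemma offLine_neg (e v : E) : offLine e (-v) = offLine e v := by
  rw [offLine, offLine, inner_neg_right, neg_smul, ← neg_sub', norm_neg]

variable [FiniteDimensional ℝ E] [MeasurableSpace E] [BorelSpace E]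

open Classical in
/-- The sharp upper bound for the number of signed sums in a closed ball. -/
theorem exists_card_signedSum_mem_closedBall_le_S {R : ℝ} {s : ℕ} (hs : 1 ≤ s)
    (hsR : (s : ℝ) - 1 ≤ R) (hRs : R < Real.sqrt (((s : ℝ) - 1) ^ 2 + 1)) :
    ∃ n₀ : ℕ, ∀ n : ℕ, n₀ ≤ n → ∀ a : Fin n → E, (∀ i, 1 ≤ ‖a i‖) → ∀ y : E,
      (Finset.univ.filter fun A => signedSum a A ∈ Metric.closedBall y R).card ≤ S n s := by
  obtain ⟨τ, ε, hτ, hε0, hε, h1, h2, h3, h4, h5⟩ := exists_thresholds hs hsR hRs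
  obtain ⟨C, hC, hanti⟩ := exists_card_signedSum_mem_closedBall_le (E := E) R hε0
  have hs1 : (1 : ℝ) ≤ s := by exact_mod_cast hs
  have hR : R < 1 ∨ 2 ≤ s := by
    rcases hs.eq_or_lt with rfl | h
    · left; simpa using hRs
    · exact Or.inr h
  have hτ0 : 0 ≤ τ := by
    have : (0 : ℝ) < (max s 2 : ℕ) := by exact_mod_cast (by omega)
    by_contra! hc
    nlinarith
  obtain ⟨n₀, hn₀⟩ := Filter.eventually_atTop.1 <| (eventually_S_ge hs).and <|
    (eventually_div_le_centralProb hs hC).and (Filter.eventually_ge_atTop (32 * s))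
  refine ⟨n₀, fun n hn a ha y => ?_⟩
  obtain ⟨hS, hspread, hns⟩ := hn₀ n hn
  have hS' : 2 ^ n * (((s : ℝ) - 1 / 4) * centralProb n) ≤ S n s := by
    refine le_trans (le_of_eq ?_) hS
    rw [centralProb]
    field_simp
  set K := n / (8 * s) + 1 with hK
  have hKn : n / (8 * s) ≤ n / 8 := Nat.div_le_div_left (by omega) (by norm_num)
  set F := Finset.univ.filter fun A => signedSum a A ∈ Metric.closedBall y R with hF
  let far : Fin n → Fin n → Prop := fun i j => ε ≤ offLine (‖a i‖⁻¹ • a i) (a j)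
  by_cases hfar : ∀ i, K ≤ (Finset.univ.filter (far i)).card
  · obtain ⟨f, g, hfg, hfg'⟩ := exists_disjoint_pairs far (fun i => by
      have hi : ‖a i‖ ≠ 0 := by have := ha i; positivity
      have : offLine (‖a i‖⁻¹ • a i) (a i) = 0 := by
        rw [offLine, real_inner_smul_left, real_inner_self_eq_norm_sq, smul_smul,
          show ‖a i‖⁻¹ * ‖a i‖ ^ 2 * ‖a i‖⁻¹ = 1 by field_simp, one_smul, sub_self, norm_zero]
      simpa [far, this] using hε0) hfar (by omega) (2 * (K / 4)) (by omega)
    have hK4 : K / 4 ≠ 0 := by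
      have : 4 ≤ n / (8 * s) := by
        rw [Nat.le_div_iff_mul_le (by omega)]; omega
      omega
    have h6 := hanti n (K / 4) a f g hK4 hfg ha hfg' y F fun A hA => (Finset.mem_filter.1 hA).2
    have h7 : (F.card : ℝ) ≤ S n s := by
      refine h6.trans (le_trans ?_ hS')
      gcongr
      refine hspread.trans ?_
      have := centralProb_pos n
      gcongr
      linarith
    exact_mod_cast h7
  · push Not at hfar
    obtain ⟨i, hi⟩ := hfar
    set e := ‖a i‖⁻¹ • a i with he_def
    have he : ‖e‖ = 1 := by
      have hi : ‖a i‖ ≠ 0 := by have := ha i; positivity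
      rw [he_def, norm_smul, norm_inv, norm_norm, inv_mul_cancel₀ hi]
    set G := (Finset.univ.filter (far i))ᶜ with hG
    have hGn : n - n / (8 * s) ≤ G.card := by
      rw [hG, Finset.card_compl, Fintype.card_fin]
      omega
    -- Negating the vectors indexed by T makes every component along e nonnegative and keeps
    -- distances to the line.
    set T : Finset (Fin n) := Finset.univ.filter fun j => ⟪e, a j⟫ < 0 with hT
    set b : Fin n → E := fun j => -(signs T j • a j) with hb
    have hb' : ∀ j, b j = -a j ∧ ⟪e, a j⟫ < 0 ∨ b j = a j ∧ 0 ≤ ⟪e, a j⟫ := fun j => by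
      rcases lt_or_ge ⟪e, a j⟫ 0 with h | h
      · exact Or.inl ⟨by simp [hb, hT, signs, h], h⟩
      · exact Or.inr ⟨by simp [hb, hT, signs, h.not_gt], h⟩
    have hFb : F.card = (Finset.univ.filter fun A =>
        signedSum b A ∈ Metric.closedBall y R).card :=
      (card_signedSum_neg_signs a T (Metric.closedBall y R)).symm
    rw [hFb]
    rcases card_le_S_or_card_le hs (by omega) hR hτ hε h1 h2 h3 h4 h5 hτ0 he
      (a := b) (fun j => by rcases hb' j with ⟨h, -⟩ | ⟨h, -⟩ <;> simpa [h] using ha j)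
      (fun j => by
        rcases hb' j with ⟨h, h'⟩ | ⟨h, h'⟩
        · rw [h, inner_neg_right]; linarith
        · rwa [h])
      y _ (fun A hA => (Finset.mem_filter.1 hA).2) G (fun j hj => by
        have : offLine e (a j) ≤ ε := by
          rw [hG, Finset.mem_compl, Finset.mem_filter] at hj
          simp only [Finset.mem_univ, true_and, far, not_le] at hj
          exact hj.le
        rcases hb' j with ⟨h, -⟩ | ⟨h, -⟩
        · rwa [h, offLine_neg]
        · rwa [h]) with h | ⟨hlt, h⟩
    · exact h
    · set N := G.card with hN
      have h6 : (8 * s - 1) * n ≤ 8 * s * (N : ℝ) := by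
        have h7 : 8 * s * (n / (8 * s)) ≤ n := Nat.mul_div_le n _
        have h8 : n ≤ N + n / (8 * s) := by omega
        have h9 : (n : ℝ) ≤ N + (n / (8 * s) : ℕ) := by exact_mod_cast h8
        have h10 : 8 * (s : ℝ) * (n / (8 * s) : ℕ) ≤ n := by exact_mod_cast h7
        nlinarith
      have h7 := mul_centralProb_le hs (by omega) hlt.le h6
      -- The middle factor 2, for the sign of the exceptional vector, turns 2s - 1 into s - 1/2.
      have h8 : (2 : ℝ) ^ n = 2 ^ (n - N - 1) * 2 * 2 ^ N := by
        rw [← pow_succ, ← pow_add]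
        congr 1
        omega
      have h9 : ((2 ^ (n - N - 1) * ((2 * s - 1) * N.choose (N / 2)) : ℕ) : ℝ) ≤ S n s := by
        refine le_trans (le_of_eq ?_) ((mul_le_mul_of_nonneg_left h7 (by positivity)).trans hS')
        rw [h8, centralProb]
        push_cast [Nat.cast_sub (show 1 ≤ 2 * s by omega)]
        field_simp
      exact h.trans (by exact_mod_cast h9)

end UpperBound

/-! ### The lower bound from equal vectors -/

section LowerBound

-- The signed sum depends only on |A|, and the centre is the midpoint of the values on the central
-- layers. The abstract B serves closed and open balls alike.
open Classical in
lemma S_le_card_signedSum_const {E : Type*} [NormedAddCommGroup E] [InnerProductSpace ℝ E]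
    {n s : ℕ} (hs : 1 ≤ s) (hn : s ≤ n + 1) {e : E} (he : ‖e‖ = 1) (B : E → Set E)
    (hB : ∀ y z, ‖z - y‖ ≤ s - 1 → z ∈ B y) :
    ∃ y, S n s ≤ (Finset.univ.filter fun A => signedSum (fun _ : Fin n => e) A ∈ B y).card := by
  set r := (n + 1 - s) / 2 with hr
  refine ⟨(2 * r + (s - 1) - n : ℝ) • e, ?_⟩
  have h1 := Finset.sum_powerset_apply_card (fun j => if j ∈ centralLayers n s then 1 else 0)
    (x := (Finset.univ : Finset (Fin n)))
  rw [Finset.powerset_univ, Finset.card_univ, Fintype.card_fin, ← Finset.card_filter] at h1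
  simp only [smul_eq_mul, mul_ite, mul_one, mul_zero] at h1
  rw [Finset.sum_ite_mem, Finset.inter_eq_right.2 (centralLayers_subset hn),
    ← S_eq_sum_centralLayers hs hn] at h1
  rw [← h1]
  refine Finset.card_le_card fun A hA => ?_
  simp only [Finset.mem_filter, Finset.mem_univ, true_and, centralLayers, Finset.mem_Ico,
    ← hr] at hA ⊢
  refine hB _ _ ?_
  rw [signedSum_const, Fintype.card_fin, ← sub_smul, norm_smul, he, mul_one, Real.norm_eq_abs,
    abs_le]
  have h2 : (r : ℝ) ≤ A.card := by exact_mod_cast hA.1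
  have h3 : (A.card : ℝ) + 1 ≤ r + s := by exact_mod_cast hA.2
  constructor <;> linarith

end LowerBound

end LittlewoodOfford

theorem mainTheorem1 (d : ℕ) (hd : 1 ≤ d) (R : ℝ) (hR : 0 < R) (s : ℕ) (hs : s = ⌊R⌋₊ + 1)
    (hsR : (s : ℝ) - 1 ≤ R) (hRs : R < Real.sqrt (((s : ℝ) - 1) ^ 2 + 1)) :
    ∃ n₀ : ℕ, ∀ n : ℕ, n₀ ≤ n →
      LittlewoodOfford.p d R LittlewoodOfford.bernoulliSign n
          = (LittlewoodOfford.S n s : ℝ≥0∞) / 2 ^ n ∧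
      ((s : ℝ) - 1 < R →
        LittlewoodOfford.pOpen d R LittlewoodOfford.bernoulliSign n
          = (LittlewoodOfford.S n s : ℝ≥0∞) / 2 ^ n) := by
  classical
  have hs1 : 1 ≤ s := by omega
  obtain ⟨n₀, h⟩ := LittlewoodOfford.exists_card_signedSum_mem_closedBall_le_S
    (E := EuclideanSpace ℝ (Fin d)) hs1 hsR hRs
  refine ⟨max n₀ s, fun n hn => ?_⟩
  have hupper := h n (le_of_max_le_left hn)
  have hsn : s ≤ n + 1 := (le_of_max_le_right hn).trans n.le_succ
  set e : EuclideanSpace ℝ (Fin d) := EuclideanSpace.single ⟨0, hd⟩ 1 with he_def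
  have he : ‖e‖ = 1 := by simp [he_def]
  refine ⟨le_antisymm (iSup₂_le fun a ha => iSup_le fun y => ?_) ?_,
    fun hlt => le_antisymm (iSup₂_le fun a ha => iSup_le fun y => ?_) ?_⟩
  · rw [LittlewoodOfford.sumProb_bernoulliSign a Metric.isClosed_closedBall.measurableSet]
    gcongr
    exact hupper a ha y
  · obtain ⟨y, hy⟩ := LittlewoodOfford.S_le_card_signedSum_const hs1 hsn he
      (fun y => Metric.closedBall y R) fun y z hz => mem_closedBall_iff_norm.2 (hz.trans hsR)
    refine le_iSup₂_of_le (fun _ => e) (fun _ => he.ge) (le_iSup_of_le y ?_)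
    rw [LittlewoodOfford.sumProb_bernoulliSign _ Metric.isClosed_closedBall.measurableSet]
    gcongr
  · rw [LittlewoodOfford.sumProb_bernoulliSign a Metric.isOpen_ball.measurableSet]
    gcongr
    refine le_trans (Finset.card_le_card fun A hA => ?_) (hupper a ha y)
    rw [Finset.mem_filter] at hA ⊢
    exact ⟨hA.1, Metric.ball_subset_closedBall hA.2⟩
  · obtain ⟨y, hy⟩ := LittlewoodOfford.S_le_card_signedSum_const hs1 hsn he
      (fun y => Metric.ball y R) fun y z hz => mem_ball_iff_norm.2 (hz.trans_lt hlt)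
    refine le_iSup₂_of_le (fun _ => e) (fun _ => he.ge) (le_iSup_of_le y ?_)
    rw [LittlewoodOfford.sumProb_bernoulliSign _ Metric.isOpen_ball.measurableSet]
    gcongr
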